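/- Let $\mathbb{F}$ be a field and let $X$, $Y$ be finite metric spaces. The Čech filtration of $X$ is the monotone function $F^{\mathrm C}_X(\sigma)=\min_{p\in X}\max_{x\in\sigma}d_X(x,p)$ on the subsets $\sigma\subseteq X$. For $k\in\mathbb{N}$, the simplicial homology groups $H_k(L_\varepsilon;\mathbb{F})$ of the complexes $L_\varepsilon=\{\emptyset\ne\sigma\subseteq X : F^{\mathrm C}_X(\sigma)\le\varepsilon\}$, $\varepsilon\in\mathbb{R}$, with the maps induced by the inclusions $L_\varepsilon\subseteq L_{\varepsilon'}$ for $\varepsilon\le\varepsilon'$, form a persistence vector space. Its persistence diagram $\mathrm D_k(F^{\mathrm C}_X)$ is the unique finite multiset of pairs $(b,d)$ with $b\in\mathbb{R}$, $d\in\mathbb{R}\cup\{\infty\}$, $b<d$, such that this persistence vector space is isomorphic to the direct sum of the interval modules of the intervals $[b,d)$. For two finite diagrams $D_1=\{P_\alpha\}_{\alpha\in A_1}$ and $D_2=\{Q_\alpha\}_{\alpha\in A_2}$ the bottleneck distance $d_{\mathcal D}(D_1,D_2)$ is the minimum, over all bijections $\varphi:B_1\to B_2$ between subsets $B_i\subseteq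 A_i$, of $$\max\Big(\max_{\beta\in B_1}\|P_\beta-Q_{\varphi(\beta)}\|_\infty,\ \max_{\alpha\in A_1\setminus B_1}\tfrac12\mathrm{pers}(P_\alpha),\ \max_{\alpha\in A_2\setminus B_2}\tfrac12\mathrm{pers}(Q_\alpha)\Big)\in[0,\infty],$$ where $\mathrm{pers}(b,d)=d-b$, $|\infty-\infty|=0$, $|\infty-t|=\infty$ for real $t$, and a maximum over the empty set is $0$. The Gromov–Hausdorff distance is $d_{\mathrm{GH}}(X,Y)=\frac12\inf_R\sup_{(x,y),(x',y')\in R}|d_X(x,x')-d_Y(y,y')|$, where $R$ ranges over the subsets of $X\times Y$ that project onto $X$ and onto $Y$ (with $\inf\emptyset=\infty$, and a supremum over the empty set is $0$; this matters only for empty spaces). Theorem. For all finite metric spaces $X$ and $Y$ and all $k\in\mathbb{N}$, the persistence diagrams $\mathrm D_k(F^{\mathrm C}_X)$ and $\mathrm D_k(F^{\mathrm C}_Y)$ exist and are unique, and $$d_{\mathcal D}\big(\mathrm D_k(F^{\mathrm C}_X),\mathrm D_k(F^{\mathrm C}_Y)\big)\le 2\,d_{\mathrm{GH}}(X,Y).$$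 -/

import Mathlib

open scoped ENNReal

noncomputable section

namespace PersistentHomology

/-! ### Filtrations on a finite set and their sublevel complexes -/

/-- A filtration over `X`: a real-valued function on the finite subsets of `X` (for finite `X`
these are all subsets) that is monotone with respect to inclusion. -/
structure Filtration (X : Type*) where
  val : Finset X → ℝ
  mono : Monotone val

/-- The complex `L_ε = {σ | val σ ≤ ε}`; as usual its simplices are nonempty. It need not contain
every point of `X` as a vertex. -/
def Filtration.sublevel {X : Type*} (Φ : Filtration X) (ε : ℝ) : PreAbstractSimplicialComplex X where
  faces := {σ | σ.Nonempty ∧ Φ.val σ ≤ ε}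
  isRelLowerSet_faces := fun _ hσ => ⟨hσ.1, fun _ hτσ hτ => ⟨hτ, (Φ.mono hτσ).trans hσ.2⟩⟩

theorem Filtration.sublevel_mono {X : Type*} (Φ : Filtration X) {ε ε' : ℝ} (h : ε ≤ ε') :
    Φ.sublevel ε ≤ Φ.sublevel ε' :=
  fun _ hσ => ⟨hσ.1, hσ.2.trans h⟩

/-! ### Simplicial homology with coefficients in a field -/

section Homology

variable (F : Type*) [Field F] {X : Type*}

/-- Formal `F`-linear combinations of the tuples `(v₀, …, vₙ)` of elements of `X`. -/
def TupleSpace (X : Type*) (n : ℕ) : Type _ := (Fin (n + 1) → X) →₀ F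

instance (X : Type*) (n : ℕ) : AddCommGroup (TupleSpace F X n) :=
  inferInstanceAs (AddCommGroup ((Fin (n + 1) → X) →₀ F))

instance (X : Type*) (n : ℕ) : Module F (TupleSpace F X n) :=
  inferInstanceAs (Module F ((Fin (n + 1) → X) →₀ F))

/-- The tuple `(v₀, …, vₙ)` as a basis vector. -/
def tuple {n : ℕ} (v : Fin (n + 1) → X) : TupleSpace F X n := Finsupp.single v (1 : F)

/-- The simplicial boundary, the linear map with
`∂ (v₀, …, vₙ₊₁) = ∑ᵢ (-1)ⁱ (v₀, …, vᵢ₋₁, vᵢ₊₁, …, vₙ₊₁)`. -/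
def boundary (X : Type*) (n : ℕ) : TupleSpace F X (n + 1) →ₗ[F] TupleSpace F X n :=
  Finsupp.linearCombination F fun v : Fin (n + 2) → X =>
    ∑ i : Fin (n + 2), (-1 : F) ^ (i : ℕ) • tuple F (fun j => v (i.succAbove j))

/-- The ordered `n`-chains of `L`: combinations of the tuples `(v₀, …, vₙ)` (repetitions allowed)
whose entries span a simplex of `L`. -/
def chains (L : PreAbstractSimplicialComplex X) (n : ℕ) : Submodule F (TupleSpace F X n) :=
  Submodule.span F (tuple F '' {v | ∃ σ ∈ L.faces, (σ : Set X) = Set.range v})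

/-- The `n`-cycles of `L`; every `0`-chain is a cycle (homology is not reduced). -/
def cycles (L : PreAbstractSimplicialComplex X) : (n : ℕ) → Submodule F (TupleSpace F X n)
  | 0 => chains F L 0
  | n + 1 => chains F L (n + 1) ⊓ LinearMap.ker (boundary F X n)

/-- The `n`-boundaries of `L`. -/
def boundaries (L : PreAbstractSimplicialComplex X) (n : ℕ) :
    Submodule F (TupleSpace F X n) :=
  (chains F L (n + 1)).map (boundary F X n)

/-- `H_n(L; F)`, cycles modulo boundaries. -/
abbrev Homology (L : PreAbstractSimplicialComplex X) (n : ℕ) :=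
  cycles F L n ⧸ (boundaries F L n).submoduleOf (cycles F L n)

variable {F}

theorem chains_mono {L L' : PreAbstractSimplicialComplex X} (h : L ≤ L') (n : ℕ) :
    chains F L n ≤ chains F L' n :=
  Submodule.span_mono (Set.image_mono fun _ ⟨σ, hσ, e⟩ => ⟨σ, h hσ, e⟩)

theorem cycles_mono {L L' : PreAbstractSimplicialComplex X} (h : L ≤ L') :
    ∀ n : ℕ, cycles F L n ≤ cycles F L' n
  | 0 => chains_mono h 0
  | n + 1 => inf_le_inf_right _ (chains_mono h (n + 1))

theorem boundaries_mono {L L' : PreAbstractSimplicialComplex X} (h : L ≤ L') (n : ℕ) :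
    boundaries F L n ≤ boundaries F L' n :=
  Submodule.map_mono (chains_mono h (n + 1))

/-- The map `H_n(L; F) → H_n(L'; F)` induced by an inclusion `L ⊆ L'`. -/
def homologyMap {L L' : PreAbstractSimplicialComplex X} (h : L ≤ L') (n : ℕ) :
    Homology F L n →ₗ[F] Homology F L' n :=
  Submodule.mapQ _ _ (Submodule.inclusion (cycles_mono h n))
    fun _ hx => boundaries_mono h n hx

end Homology

/-! ### Persistence vector spaces and persistence diagrams -/

/-- A persistence vector space indexed by the real line. -/
structure PersistenceModule (F : Type*) [Field F] where
  space : ℝ → Type*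
  [addCommGroup : ∀ ε, AddCommGroup (space ε)]
  [module : ∀ ε, Module F (space ε)]
  map : ∀ {ε ε' : ℝ}, ε ≤ ε' → space ε →ₗ[F] space ε'
  map_refl : ∀ (ε : ℝ) (x : space ε), map (le_refl ε) x = x
  map_trans : ∀ {ε ε' ε'' : ℝ} (h : ε ≤ ε') (h' : ε' ≤ ε'') (x : space ε),
    map h' (map h x) = map (h.trans h') x

attribute [instance] PersistenceModule.addCommGroup PersistenceModule.module

/-- The degree `k` persistent homology of a filtration. -/
def Filtration.persistentHomology {X : Type*} (Φ : Filtration X) (F : Type*) [Field F] (k : ℕ) :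
    PersistenceModule F where
  space ε := Homology F (Φ.sublevel ε) k
  map h := homologyMap (Φ.sublevel_mono h) k
  map_refl ε x := by
    obtain ⟨x, rfl⟩ := Submodule.Quotient.mk_surjective _ x
    rfl
  map_trans h h' x := by
    obtain ⟨x, rfl⟩ := Submodule.Quotient.mk_surjective _ x
    rfl

/-- Isomorphism of persistence vector spaces. -/
def PersistenceModule.Isomorphic {F : Type*} [Field F] (V W : PersistenceModule F) : Prop :=
  ∃ e : ∀ ε : ℝ, V.space ε ≃ₗ[F] W.space ε,
    ∀ {ε ε' : ℝ} (h : ε ≤ ε') (x : V.space ε), e ε' (V.map h x) = W.map h (e ε x)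

/-- A point `(b, d)` of a persistence diagram; it stands for the interval `[b, d)`, where `d` may
be `⊤ = ∞`. -/
abbrev Point := ℝ × WithTop ℝ

/-- `ε` lies in the interval `[b, d)`. -/
def Point.Alive (P : Point) (ε : ℝ) : Prop := P.1 ≤ ε ∧ (ε : WithTop ℝ) < P.2

open Classical in
/-- The direct sum, over the points `P = (b, d)` of the finite multiset `D`, of the interval
modules of `[b, d)`. The summand of `P` is `F` at the parameters in `[b, d)` and `0` elsewhere,
and its transition maps are the identity between two parameters in `[b, d)` and zero otherwise. -/
def intervalSum (F : Type*) [Field F] (D : Multiset Point) : PersistenceModule F where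
  space ε := {a : D // Point.Alive a.1 ε} → F
  map {ε ε'} _ :=
    { toFun := fun x a => if ha : Point.Alive a.1.1 ε then x ⟨a.1, ha⟩ else 0
      map_add' := fun x y => by
        funext a
        by_cases ha : Point.Alive a.1.1 ε <;> simp [ha]
      map_smul' := fun c x => by
        funext a
        by_cases ha : Point.Alive a.1.1 ε <;> simp [ha] }
  map_refl ε x := by
    funext a
    simp [a.2]
  map_trans {ε ε' ε''} h h' x := by
    funext a
    by_cases ha : Point.Alive a.1.1 ε
    · have ha' : Point.Alive a.1.1 ε' :=
        ⟨ha.1.trans h, lt_of_le_of_lt (WithTop.coe_le_coe.2 h') a.2.2⟩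
      simp [ha, ha']
    · simp [ha]

/-- `D` is the persistence diagram of `V`: a finite multiset of nonempty intervals `[b, d)` such
that `V` is isomorphic to the direct sum of the corresponding interval modules. -/
def IsDiagram {F : Type*} [Field F] (V : PersistenceModule F) (D : Multiset Point) : Prop :=
  (∀ P ∈ D, (P.1 : WithTop ℝ) < P.2) ∧ V.Isomorphic (intervalSum F D)

/-! ### The bottleneck distance -/

/-- The distance `|d - d'|` of two elements of `ℝ ∪ {∞}`, with `|∞ - ∞| = 0` and
`|∞ - d| = |d - ∞| = ∞` for real `d`. -/
def extDist : WithTop ℝ → WithTop ℝ → ℝ≥0∞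
  | some d, some d' => ENNReal.ofReal |d - d'|
  | none, none => 0
  | none, some _ => ⊤
  | some _, none => ⊤

/-- The `ℓ^∞` distance of two points of persistence diagrams. -/
def Point.supDist (P Q : Point) : ℝ≥0∞ := max (extDist P.1 Q.1) (extDist P.2 Q.2)

/-- The persistence `d - b` of a point `(b, d)` with `b ≤ d`. -/
def Point.pers (P : Point) : ℝ≥0∞ := extDist P.2 P.1

/-- The cost `J(φ)` of a partial matching, that is, of a bijection `φ : B₁ → B₂` between subsets
of (the index sets of) the two diagrams. -/
def matchingCost {D₁ D₂ : Multiset Point} {B₁ : Set D₁} {B₂ : Set D₂} (φ : B₁ ≃ B₂) : ℝ≥0∞ :=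
  (⨆ β : B₁, Point.supDist β.1.1 (φ β).1.1) ⊔
    (⨆ α : (B₁ᶜ : Set D₁), Point.pers α.1.1 / 2) ⊔
    (⨆ α : (B₂ᶜ : Set D₂), Point.pers α.1.1 / 2)

/-- The bottleneck distance of two finite persistence diagrams (there are only finitely many
partial matchings, so that the infimum is a minimum). -/
def bottleneckDist (D₁ D₂ : Multiset Point) : ℝ≥0∞ :=
  ⨅ (B₁ : Set D₁) (B₂ : Set D₂) (φ : B₁ ≃ B₂), matchingCost φ

/-! ### The Čech filtration and the Gromov–Hausdorff distance -/

/-- The Čech filtration of a finite metric space: `σ` enters at its circumradius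
`min_{p ∈ X} max_{x ∈ σ} d(x, p)`. -/
def cechFiltration (X : Type*) [MetricSpace X] [Finite X] : Filtration X where
  val σ := ⨅ p : X, ⨆ x : σ, dist (x : X) p
  mono := by
    intro σ τ h
    refine ciInf_mono (Set.finite_range _).bddBelow fun p => ?_
    refine Real.iSup_le (fun x => ?_) (Real.iSup_nonneg fun _ => dist_nonneg)
    exact le_ciSup (f := fun y : τ => dist (y : X) p) (Set.finite_range _).bddAbove ⟨x, h x.2⟩

/-- A correspondence: a subset of `X × Y` that projects onto `X` and onto `Y`. -/
def IsCorrespondence {X Y : Type*} (R : Set (X × Y)) : Prop :=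
  Prod.fst '' R = Set.univ ∧ Prod.snd '' R = Set.univ

/-- The distortion `sup |d_X(x, x') - d_Y(y, y')|` over `(x, y), (x', y') ∈ R`. -/
def distortion {X Y : Type*} [MetricSpace X] [MetricSpace Y] (R : Set (X × Y)) : ℝ≥0∞ :=
  ⨆ (p ∈ R) (q ∈ R), ENNReal.ofReal |dist p.1 q.1 - dist p.2 q.2|

/-- The Gromov–Hausdorff distance, half the infimum of the distortions of all correspondences. -/
def gromovHausdorffDist (X Y : Type*) [MetricSpace X] [MetricSpace Y] : ℝ≥0∞ :=
  (⨅ (R : Set (X × Y)) (_ : IsCorrespondence R), distortion R) / 2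

end PersistentHomology

end

noncomputable section

namespace PersistentHomology

/-! ### Bases adapted to two chains of subspaces -/

section Adapted

variable {F V : Type*} [Field F] [AddCommGroup V] [Module F V]

/-! A correspondence `R` is itself a finite set that surjects onto `X` and onto `Y`, so both Čech
filtrations can be pulled back to it. Pulling back along a surjection does not change persistent
homology (`Filtration.comap_isomorphic`), because a section is an inverse up to contiguity. On `R`
the two pullbacks differ by at most the distortion (`cechFiltration_comap_le`). What remains is
stability for two filtrations of one finite set (`Filtration.matched_of_abs_sub_le`).

Join these by the segment `(1 - t) Φ + t Ψ`. As there are finitely many simplices, filtrations close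
to a given one on the segment never reverse its strict inequalities. For such a comparable pair all
sublevel complexes form one chain, so their cycle spaces form a chain of subspaces of the
finite-dimensional space of ordered tuples, and so do their boundary spaces. Two chains of subspaces
have a common adapted basis (`exists_basis_adapted`). In each of the two filtrations every basis
vector has a threshold for being a cycle and one for being a boundary; these are the ends of its
interval, and they move by at most the distance of the filtrations. Matching along the basis
(`matched_of_index`) therefore costs at most that distance, and the costs of consecutive pieces of
the segment add up to the total.

The adapted basis for `Φ = Ψ` also gives existence of the diagram. For uniqueness, the ranks of the
transition maps count the intervals that are alive throughout `[ε, ε']`, and these counts determine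
the diagram. -/

/-- Induction over a hyperplane `H` of `U` that contains every proper trace of `A`: the members of
`A` then impose no condition on the vector `v` added to an adapted basis of `H`, and `v` can be
chosen to suit `B` alone. -/
theorem exists_linearIndepOn_adapted [FiniteDimensional F V] {A B : Set (Submodule F V)}
    (hA : IsChain (· ≤ ·) A) (hB : IsChain (· ≤ ·) B) (U : Submodule F V) :
    ∃ S : Set V, S ⊆ U ∧ LinearIndepOn F id S ∧ U ≤ Submodule.span F S ∧
      ∀ W ∈ A ∪ B, U ⊓ W ≤ Submodule.span F (S ∩ W) := by
  induction U using WellFoundedLT.induction with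
  | ind U ih =>
  by_cases hU : U = ⊥
  · subst hU
    exact ⟨∅, by simp, linearIndepOn_empty _ _, by simp, by simp⟩
  -- the largest proper trace of a member of `A`
  obtain ⟨M, ⟨hMU, hM⟩, hMmax⟩ := (wellFounded_gt (α := Submodule F V)).has_min
    {M | M < U ∧ (M = ⊥ ∨ ∃ W ∈ A, M = U ⊓ W)} ⟨⊥, bot_lt_iff_ne_bot.2 hU, Or.inl rfl⟩
  have hAM : ∀ W ∈ A, ¬ U ≤ W → U ⊓ W ≤ M := by
    intro W hW hUW
    have hlt : U ⊓ W < U := inf_lt_left.2 hUW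
    have hno := hMmax (U ⊓ W) ⟨hlt, Or.inr ⟨W, hW, rfl⟩⟩
    rcases hM with rfl | ⟨W', hW', rfl⟩
    · by_contra hne
      exact hno (bot_lt_iff_ne_bot.2 fun h => hne h.le)
    · rcases hA.total hW hW' with h | h
      · exact inf_le_inf_left _ h
      · by_contra hne
        exact hno (lt_of_le_not_ge (inf_le_inf_left _ h) hne)
  obtain ⟨H, hMH, hHU⟩ := exists_le_covBy_of_lt hMU
  obtain ⟨S, hSH, hSi, hSs, hSW⟩ := ih H hHU.lt
  -- the smallest trace of a member of `B` that is not contained in `H`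
  obtain ⟨N, ⟨hNH, hN⟩, hNmin⟩ := (wellFounded_lt (α := Submodule F V)).has_min
    {N | ¬ N ≤ H ∧ (N = U ∨ ∃ W ∈ B, N = U ⊓ W)} ⟨U, hHU.lt.not_ge, Or.inl rfl⟩
  have hNU : N ≤ U := by
    rcases hN with rfl | ⟨W, _, rfl⟩
    exacts [le_rfl, inf_le_left]
  have hBN : ∀ W ∈ B, ¬ U ⊓ W ≤ H → N ≤ U ⊓ W := by
    intro W hW hWH
    have hno := hNmin (U ⊓ W) ⟨hWH, Or.inr ⟨W, hW, rfl⟩⟩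
    rcases hN with rfl | ⟨W', hW', rfl⟩
    · by_contra hne
      exact hno (lt_of_le_not_ge inf_le_left hne)
    · rcases hB.total hW' hW with h | h
      · exact inf_le_inf_left _ h
      · by_contra hne
        exact hno (lt_of_le_not_ge (inf_le_inf_left _ h) hne)
  -- By minimality of `N`, this `v` lies in every member of `B` whose trace on `U` leaves `H`.
  obtain ⟨v, hvN, hvH⟩ := SetLike.not_le_iff_exists.1 hNH
  have hvU : v ∈ U := hNU hvN
  have hdec : ∀ x ∈ U, ∃ h ∈ H, ∃ c : F, x = h + c • v := by
    have hsup : H ⊔ Submodule.span F {v} = U := by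
      refine (hHU.eq_or_eq le_sup_left (sup_le hHU.le ?_)).resolve_left fun h => hvH ?_
      · simpa using hvU
      · rw [← h]
        exact Submodule.mem_sup_right (Submodule.mem_span_singleton_self v)
    intro x hx
    rw [← hsup] at hx
    obtain ⟨h, hh, y, hy, rfl⟩ := Submodule.mem_sup.1 hx
    obtain ⟨c, rfl⟩ := Submodule.mem_span_singleton.1 hy
    exact ⟨h, hh, c, rfl⟩
  have hS : H = Submodule.span F S := le_antisymm hSs (Submodule.span_le.2 hSH)
  have hspan : U ≤ Submodule.span F (insert v S) := by
    intro x hx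
    obtain ⟨h, hh, c, rfl⟩ := hdec x hx
    exact add_mem (Submodule.span_mono (Set.subset_insert _ _) (hSs hh))
      (Submodule.smul_mem _ _ (Submodule.subset_span (Set.mem_insert _ _)))
  refine ⟨insert v S, Set.insert_subset hvU (hSH.trans hHU.le), hSi.id_insert (hS ▸ hvH),
    hspan, fun W hW => ?_⟩
  have hmono : Submodule.span F (S ∩ W) ≤ Submodule.span F (insert v S ∩ W) :=
    Submodule.span_mono (Set.inter_subset_inter_left _ (Set.subset_insert _ _))
  by_cases hWH : U ⊓ W ≤ H
  · exact (le_inf hWH inf_le_right).trans ((hSW W hW).trans hmono)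
  rcases hW with hWA | hWB
  · have hUW : U ≤ W := by
      by_contra h
      exact hWH ((hAM W hWA h).trans hMH)
    rw [Set.inter_eq_left.2 (Set.insert_subset (hUW hvU) (hSH.trans (hHU.le.trans hUW)))]
    exact inf_le_left.trans hspan
  · have hvW : v ∈ W := (hBN W hWB hWH hvN).2
    rintro x ⟨hxU, hxW⟩
    obtain ⟨h, hh, c, rfl⟩ := hdec x hxU
    have hhW : h ∈ W := by
      simpa using sub_mem hxW (W.smul_mem c hvW)
    exact add_mem (hmono (hSW W (Or.inr hWB) ⟨hh, hhW⟩))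
      (Submodule.smul_mem _ _ (Submodule.subset_span ⟨Set.mem_insert _ _, hvW⟩))

/-- Two chains of subspaces of a finite-dimensional space have a common adapted basis. -/
theorem exists_basis_adapted [FiniteDimensional F V] {A B : Set (Submodule F V)}
    (hA : IsChain (· ≤ ·) A) (hB : IsChain (· ≤ ·) B) :
    ∃ (S : Set V) (b : Module.Basis S F V),
      ∀ W ∈ A ∪ B, ∀ x ∈ W, ∀ i, b i ∉ W → b.repr x i = 0 := by
  obtain ⟨S, -, hSi, hSs, hSW⟩ := exists_linearIndepOn_adapted hA hB (⊤ : Submodule F V)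
  let b : Module.Basis S F V := Module.Basis.mk hSi (by simpa using hSs)
  refine ⟨S, b, fun W hW x hx i hi => ?_⟩
  have hb : ∀ j, b j = j := fun j => Module.Basis.mk_apply _ _ j
  have hx' := hSW W hW ⟨trivial, hx⟩
  have himg : S ∩ W = b '' {j | b j ∈ W} := by
    ext y
    constructor
    · rintro ⟨hy, hyW⟩
      exact ⟨⟨y, hy⟩, by simpa [hb] using hyW, hb _⟩
    · rintro ⟨j, hj, rfl⟩
      exact ⟨by rw [hb]; exact j.2, hj⟩
  rw [himg, Module.Basis.mem_span_image] at hx'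
  by_contra hne
  exact hi (hx' (Finsupp.mem_support_iff.2 hne))

end Adapted

/-! ### Cones, chain maps and chain homotopies -/

section Simplicial

variable {F : Type*} [Field F] {X Y : Type*}

@[simp]
theorem boundary_tuple {n : ℕ} (v : Fin (n + 2) → X) :
    boundary F X n (tuple F v) =
      ∑ i : Fin (n + 2), (-1 : F) ^ (i : ℕ) • tuple F fun j => v (i.succAbove j) := by
  refine (Finsupp.linearCombination_single F _ _).trans (one_smul _ _)

theorem tupleSpace_hom_ext {n : ℕ} {M : Type*} [AddCommGroup M] [Module F M]
    {f g : TupleSpace F X n →ₗ[F] M} (h : ∀ v, f (tuple F v) = g (tuple F v)) : f = g :=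
  Finsupp.lhom_ext' fun v => LinearMap.ext_ring (h v)

/-- The linear map with prescribed values on the tuples. -/
def tupleLift {n : ℕ} {M : Type*} [AddCommGroup M] [Module F M] (f : (Fin (n + 1) → X) → M) :
    TupleSpace F X n →ₗ[F] M :=
  Finsupp.linearCombination F f

@[simp]
theorem tupleLift_tuple {n : ℕ} {M : Type*} [AddCommGroup M] [Module F M]
    (f : (Fin (n + 1) → X) → M) (v : Fin (n + 1) → X) : tupleLift f (tuple F v) = f v :=
  (Finsupp.linearCombination_single F _ _).trans (one_smul _ _)

/-- The chain map `(v₀, …, vₙ) ↦ (g v₀, …, g vₙ)`. -/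
def mapTuples (F : Type*) [Field F] (g : X → Y) (n : ℕ) : TupleSpace F X n →ₗ[F] TupleSpace F Y n :=
  tupleLift fun v => tuple F (g ∘ v)

@[simp]
theorem mapTuples_tuple (g : X → Y) {n : ℕ} (v : Fin (n + 1) → X) :
    mapTuples F g n (tuple F v) = tuple F (g ∘ v) :=
  tupleLift_tuple _ _

theorem boundary_mapTuples (g : X → Y) (n : ℕ) (x : TupleSpace F X (n + 1)) :
    boundary F Y n (mapTuples F g (n + 1) x) = mapTuples F g n (boundary F X n x) := by
  have : boundary F Y n ∘ₗ mapTuples F g (n + 1) = mapTuples F g n ∘ₗ boundary F X n :=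
    tupleSpace_hom_ext fun v => by simp [Function.comp_def]
  exact LinearMap.congr_fun this x

/-- The cone operator `(v₀, …, vₙ) ↦ (p, v₀, …, vₙ)`. -/
def cone (F : Type*) [Field F] (p : X) (n : ℕ) : TupleSpace F X n →ₗ[F] TupleSpace F X (n + 1) :=
  tupleLift fun v => tuple F (Fin.cons p v : Fin (n + 2) → X)

@[simp]
theorem cone_tuple (p : X) {n : ℕ} (v : Fin (n + 1) → X) :
    cone F p n (tuple F v) = tuple F (Fin.cons p v : Fin (n + 2) → X) :=
  tupleLift_tuple _ _

theorem boundary_cone (p : X) (n : ℕ) (x : TupleSpace F X (n + 1)) :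
    boundary F X (n + 1) (cone F p (n + 1) x) = x - cone F p n (boundary F X n x) := by
  have : boundary F X (n + 1) ∘ₗ cone F p (n + 1) =
      LinearMap.id - cone F p n ∘ₗ boundary F X n := by
    refine tupleSpace_hom_ext fun v => ?_
    simp only [LinearMap.comp_apply, cone_tuple, boundary_tuple, LinearMap.sub_apply,
      LinearMap.id_apply, map_sum, map_smul]
    rw [Fin.sum_univ_succ, sub_eq_add_neg, ← Finset.sum_neg_distrib]
    congr 1
    · simp
    · refine Finset.sum_congr rfl fun i _ => ?_
      have : (fun j => (Fin.cons p v : Fin (n + 3) → X) (i.succ.succAbove j)) =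
          (Fin.cons p fun j => v (i.succAbove j) : Fin (n + 2) → X) := by
        funext j
        refine Fin.cases ?_ (fun j => ?_) j
        · simp
        · simp [Fin.succ_succAbove_succ]
      rw [this, Fin.val_succ, pow_succ]
      simp
  exact LinearMap.congr_fun this x

/-- Degree 0 has a correction term because the complex is not augmented; it cancels on combinations
of coefficient sum zero. -/
theorem boundary_cone_tuple_zero (p : X) (v : Fin 1 → X) :
    boundary F X 0 (cone F p 0 (tuple F v)) = tuple F v - tuple F fun _ => p := by
  rw [cone_tuple, boundary_tuple, Fin.sum_univ_two, sub_eq_add_neg]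
  congr 1
  · simp
  · have : (fun j => (Fin.cons p v : Fin 2 → X) ((1 : Fin 2).succAbove j)) = fun _ => p := by
      funext j
      rw [Subsingleton.elim j 0]
      rfl
    rw [this]
    simp

/-- Every tuple is the cone from its first vertex over its tail, so the cone formula reduces the
claim to one degree lower. -/
theorem boundary_boundary (n : ℕ) (x : TupleSpace F X (n + 2)) :
    boundary F X n (boundary F X (n + 1) x) = 0 := by
  have key : ∀ n, (∀ (p : X) (x : TupleSpace F X (n + 1)),
      boundary F X n (cone F p n (boundary F X n x)) = boundary F X n x) →
      boundary F X n ∘ₗ boundary F X (n + 1) = 0 := by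
    intro n h
    refine tupleSpace_hom_ext fun v => ?_
    rw [← Fin.cons_self_tail v, ← cone_tuple (F := F), LinearMap.comp_apply, boundary_cone,
      map_sub, h, sub_self, LinearMap.zero_apply]
  have hall : boundary F X n ∘ₗ boundary F X (n + 1) = 0 := by
    induction n with
    | zero =>
      refine key 0 fun p x => ?_
      have : boundary F X 0 ∘ₗ cone F p 0 ∘ₗ boundary F X 0 = boundary F X 0 := by
        refine tupleSpace_hom_ext fun v => ?_
        simp only [LinearMap.comp_apply, boundary_tuple, map_sum, map_smul]
        simp only [boundary_cone_tuple_zero]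
        simp
        abel
      exact LinearMap.congr_fun this x
    | succ n ih =>
      refine key (n + 1) fun p x => ?_
      rw [boundary_cone, show boundary F X n (boundary F X (n + 1) x) = 0 from
        LinearMap.congr_fun (ih 0) x, map_zero, sub_zero]
  exact LinearMap.congr_fun hall x

theorem tuple_mem_chains {L : PreAbstractSimplicialComplex X} {n : ℕ} {v : Fin (n + 1) → X}
    {σ : Finset X} (hσ : σ ∈ L.faces) (hv : (σ : Set X) = Set.range v) :
    tuple F v ∈ chains F L n :=
  Submodule.subset_span ⟨v, ⟨σ, hσ, hv⟩, rfl⟩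

theorem chains_le_comap {L : PreAbstractSimplicialComplex X} {n : ℕ} {M : Type*}
    [AddCommGroup M] [Module F M] {f : TupleSpace F X n →ₗ[F] M} {N : Submodule F M}
    (h : ∀ σ ∈ L.faces, ∀ v : Fin (n + 1) → X, (σ : Set X) = Set.range v → f (tuple F v) ∈ N) :
    chains F L n ≤ N.comap f := by
  refine Submodule.span_le.2 ?_
  rintro _ ⟨v, ⟨σ, hσ, hv⟩, rfl⟩
  exact h σ hσ v hv

/-- The simplex spanned by a set of vertices, with all its faces. -/
def fullSimplex (A : Set X) : PreAbstractSimplicialComplex X where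
  faces := {σ | σ.Nonempty ∧ (σ : Set X) ⊆ A}
  isRelLowerSet_faces := fun _ hσ =>
    ⟨hσ.1, fun _ hτσ hτ => ⟨hτ, (Finset.coe_subset.2 hτσ).trans hσ.2⟩⟩

open Classical in
theorem tuple_mem_chains_fullSimplex {A : Set X} {n : ℕ} {v : Fin (n + 1) → X}
    (hv : Set.range v ⊆ A) : tuple F v ∈ chains F (fullSimplex A) n :=
  tuple_mem_chains (σ := Finset.univ.image v) ⟨by simp, by simpa using hv⟩ (by simp)

theorem range_subset_of_fullSimplex {A : Set X} {n : ℕ} {v : Fin (n + 1) → X} {σ : Finset X}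
    (hσ : σ ∈ (fullSimplex A).faces) (hv : (σ : Set X) = Set.range v) : Set.range v ⊆ A :=
  hv ▸ hσ.2

theorem fullSimplex_le {L : PreAbstractSimplicialComplex X} {σ : Finset X} (hσ : σ ∈ L.faces) :
    fullSimplex (σ : Set X) ≤ L :=
  fun _ hτ => (L.isRelLowerSet_faces hσ).2 (Finset.coe_subset.1 hτ.2) hτ.1

theorem boundary_mem_chains_fullSimplex {A : Set X} {n : ℕ} {v : Fin (n + 2) → X}
    (hv : Set.range v ⊆ A) : boundary F X n (tuple F v) ∈ chains F (fullSimplex A) n := by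
  rw [boundary_tuple]
  exact sum_mem fun i _ => Submodule.smul_mem _ _ (tuple_mem_chains_fullSimplex
    ((Set.range_comp_subset_range _ _).trans hv))

theorem boundary_mem_chains {L : PreAbstractSimplicialComplex X} {n : ℕ}
    {x : TupleSpace F X (n + 1)} (hx : x ∈ chains F L (n + 1)) :
    boundary F X n x ∈ chains F L n :=
  chains_le_comap (N := chains F L n) (fun _ hσ _ hv =>
    chains_mono (fullSimplex_le hσ) n (boundary_mem_chains_fullSimplex hv.ge)) hx

theorem boundaries_le_cycles (L : PreAbstractSimplicialComplex X) :
    ∀ n : ℕ, boundaries F L n ≤ cycles F L n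
  | 0 => by
    rintro _ ⟨x, hx, rfl⟩
    exact boundary_mem_chains hx
  | n + 1 => by
    rintro _ ⟨x, hx, rfl⟩
    exact ⟨boundary_mem_chains hx, boundary_boundary n x⟩

theorem cone_mem_chains_fullSimplex {A : Set X} {p : X} (hp : p ∈ A) {n : ℕ}
    {x : TupleSpace F X n} (hx : x ∈ chains F (fullSimplex A) n) :
    cone F p n x ∈ chains F (fullSimplex A) (n + 1) := by
  refine chains_le_comap (N := chains F (fullSimplex A) (n + 1)) (fun σ hσ v hv => ?_) hx
  rw [cone_tuple]
  refine tuple_mem_chains_fullSimplex ?_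
  rw [Fin.range_cons]
  exact Set.insert_subset hp (range_subset_of_fullSimplex hσ hv)

/-- A chain homotopy from the identity to the chain map of `g`. -/
def homotopy (F : Type*) [Field F] (g : X → X) :
    (n : ℕ) → TupleSpace F X n →ₗ[F] TupleSpace F X (n + 1)
  | 0 => tupleLift fun v => cone F (v 0) 0 (tuple F (g ∘ v) - tuple F v)
  | n + 1 => tupleLift fun v => cone F (v 0) (n + 1)
      (tuple F (g ∘ v) - tuple F v - homotopy F g n (boundary F X n (tuple F v)))

theorem boundary_homotopy_zero (g : X → X) (x : TupleSpace F X 0) :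
    boundary F X 0 (homotopy F g 0 x) = mapTuples F g 0 x - x := by
  have : boundary F X 0 ∘ₗ homotopy F g 0 = mapTuples F g 0 - LinearMap.id := by
    refine tupleSpace_hom_ext fun v => ?_
    simp [homotopy, -cone_tuple, boundary_cone_tuple_zero]
  exact LinearMap.congr_fun this x

/-- The chain being coned off is a cycle by the homotopy identity one degree lower, and the boundary
of the cone over a cycle of positive degree is that cycle. -/
theorem boundary_homotopy_succ (g : X → X) (n : ℕ) (x : TupleSpace F X (n + 1)) :
    boundary F X (n + 1) (homotopy F g (n + 1) x) =
      mapTuples F g (n + 1) x - x - homotopy F g n (boundary F X n x) := by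
  -- The identity is needed only on boundaries, where the term with `∂∂` vanishes; in this form
  -- degree 0 and the higher degrees provide the same hypothesis.
  have key : ∀ n, (∀ x : TupleSpace F X (n + 1),
      boundary F X n (homotopy F g n (boundary F X n x)) =
        mapTuples F g n (boundary F X n x) - boundary F X n x) →
      boundary F X (n + 1) ∘ₗ homotopy F g (n + 1) =
        mapTuples F g (n + 1) - LinearMap.id - homotopy F g n ∘ₗ boundary F X n := by
    intro n h
    refine tupleSpace_hom_ext fun v => ?_
    have hz : boundary F X n (tuple F (g ∘ v) - tuple F v -
        homotopy F g n (boundary F X n (tuple F v))) = 0 := by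
      rw [map_sub, h, map_sub, ← mapTuples_tuple, boundary_mapTuples, sub_self]
    rw [LinearMap.comp_apply, homotopy, tupleLift_tuple, boundary_cone, hz, map_zero, sub_zero,
      ← mapTuples_tuple]
    rfl
  have hall : boundary F X (n + 1) ∘ₗ homotopy F g (n + 1) =
      mapTuples F g (n + 1) - LinearMap.id - homotopy F g n ∘ₗ boundary F X n := by
    induction n with
    | zero => exact key 0 fun x => boundary_homotopy_zero g _
    | succ n ih =>
      refine key (n + 1) fun x => ?_
      rw [show boundary F X (n + 1) (homotopy F g (n + 1) (boundary F X (n + 1) x)) = _ from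
        LinearMap.congr_fun (ih 0) _]
      simp [boundary_boundary]
  exact LinearMap.congr_fun hall x

theorem homotopy_tuple_mem (g : X → X) {n : ℕ} {A : Set X} {v : Fin (n + 1) → X}
    (hv : Set.range v ⊆ A) (hg : g '' Set.range v ⊆ A) :
    homotopy F g n (tuple F v) ∈ chains F (fullSimplex A) (n + 1) := by
  have hgv : Set.range (g ∘ v) ⊆ A := by rwa [Set.range_comp]
  induction n with
  | zero =>
    rw [homotopy, tupleLift_tuple]
    exact cone_mem_chains_fullSimplex (hv ⟨0, rfl⟩)
      (sub_mem (tuple_mem_chains_fullSimplex hgv) (tuple_mem_chains_fullSimplex hv))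
  | succ n ih =>
    rw [homotopy, tupleLift_tuple]
    refine cone_mem_chains_fullSimplex (hv ⟨0, rfl⟩) (sub_mem
      (sub_mem (tuple_mem_chains_fullSimplex hgv) (tuple_mem_chains_fullSimplex hv)) ?_)
    rw [boundary_tuple, map_sum]
    refine sum_mem fun i _ => ?_
    rw [map_smul]
    have hsub : Set.range (fun j => v (i.succAbove j)) ⊆ Set.range v :=
      Set.range_comp_subset_range _ _
    have hg' := (Set.image_mono hsub).trans hg
    exact Submodule.smul_mem _ _ (ih (hsub.trans hv) hg' (by rwa [Set.range_comp]))

open Classical in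
/-- If `σ ∪ g σ` is a simplex for every simplex `σ`, then `g` acts trivially on homology. -/
theorem mapTuples_sub_mem_boundaries {L : PreAbstractSimplicialComplex X} {g : X → X}
    (hg : ∀ σ ∈ L.faces, σ ∪ σ.image g ∈ L.faces) (n : ℕ) {z : TupleSpace F X n}
    (hz : z ∈ cycles F L n) : mapTuples F g n z - z ∈ boundaries F L n := by
  have hmem : ∀ n, ∀ x ∈ chains F L n, homotopy F g n x ∈ chains F L (n + 1) := by
    intro n
    refine chains_le_comap (N := chains F L (n + 1)) fun σ hσ v hv => ?_
    refine chains_mono (fullSimplex_le (hg σ hσ)) (n + 1) (homotopy_tuple_mem g ?_ ?_)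
    · simp [← hv]
    · simp [← hv]
  cases n with
  | zero => exact ⟨_, hmem 0 z hz, boundary_homotopy_zero g z⟩
  | succ n =>
    refine ⟨_, hmem (n + 1) z hz.1, ?_⟩
    rw [boundary_homotopy_succ, show boundary F X n z = 0 from hz.2, map_zero, sub_zero]

open Classical in
theorem mapTuples_mem_chains {L : PreAbstractSimplicialComplex X}
    {L' : PreAbstractSimplicialComplex Y} {g : X → Y}
    (hg : ∀ σ ∈ L.faces, σ.image g ∈ L'.faces) (n : ℕ) {x : TupleSpace F X n}
    (hx : x ∈ chains F L n) : mapTuples F g n x ∈ chains F L' n := by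
  refine chains_le_comap (N := chains F L' n) (fun σ hσ v hv => ?_) hx
  rw [mapTuples_tuple]
  exact tuple_mem_chains (hg σ hσ) (by rw [Finset.coe_image, hv, Set.range_comp])

open Classical in
theorem mapTuples_mem_cycles {L : PreAbstractSimplicialComplex X}
    {L' : PreAbstractSimplicialComplex Y} {g : X → Y}
    (hg : ∀ σ ∈ L.faces, σ.image g ∈ L'.faces) (n : ℕ) {x : TupleSpace F X n}
    (hx : x ∈ cycles F L n) : mapTuples F g n x ∈ cycles F L' n := by
  cases n with
  | zero => exact mapTuples_mem_chains hg 0 hx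
  | succ n =>
    refine ⟨mapTuples_mem_chains hg (n + 1) hx.1, ?_⟩
    change boundary F Y n _ = 0
    rw [boundary_mapTuples, show boundary F X n x = 0 from hx.2, map_zero]

open Classical in
theorem mapTuples_mem_boundaries {L : PreAbstractSimplicialComplex X}
    {L' : PreAbstractSimplicialComplex Y} {g : X → Y}
    (hg : ∀ σ ∈ L.faces, σ.image g ∈ L'.faces) (n : ℕ) {x : TupleSpace F X n}
    (hx : x ∈ boundaries F L n) : mapTuples F g n x ∈ boundaries F L' n := by
  obtain ⟨y, hy, rfl⟩ := hx
  exact ⟨_, mapTuples_mem_chains hg (n + 1) hy, boundary_mapTuples g n y⟩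

theorem mapTuples_mapTuples {Z : Type*} (f : X → Y) (g : Y → Z) (n : ℕ) (x : TupleSpace F X n) :
    mapTuples F g n (mapTuples F f n x) = mapTuples F (g ∘ f) n x := by
  have : mapTuples F g n ∘ₗ mapTuples F f n = mapTuples F (g ∘ f) n :=
    tupleSpace_hom_ext fun v => by simp [Function.comp_assoc]
  exact LinearMap.congr_fun this x

theorem mapTuples_id (n : ℕ) (x : TupleSpace F X n) : mapTuples F id n x = x := by
  have : mapTuples F id n = (LinearMap.id : TupleSpace F X n →ₗ[F] _) :=
    tupleSpace_hom_ext fun v => by simp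
  exact LinearMap.congr_fun this x

end Simplicial

/-! ### Diagrams from adapted bases -/

section Diagrams

variable {F : Type*} [Field F] {X : Type*}

theorem Filtration.sublevel_le_sublevel {Φ Ψ : Filtration X} {ε ε' : ℝ}
    (h : ∀ σ : Finset X, σ.Nonempty → Φ.val σ ≤ ε → Ψ.val σ ≤ ε') :
    Φ.sublevel ε ≤ Ψ.sublevel ε' :=
  fun σ hσ => ⟨hσ.1, h σ hσ.1 hσ.2⟩

/-- A monotone property of the sublevel complexes that fails for the empty complex holds
on a closed half-line. -/
theorem Filtration.exists_threshold [Finite X] (Φ : Filtration X)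
    (q : PreAbstractSimplicialComplex X → Prop) (hq : ∀ L L', L ≤ L' → q L → q L')
    (hbot : ∀ L, L.faces = ∅ → ¬ q L) :
    ∃ d : WithTop ℝ, ∀ ε : ℝ, q (Φ.sublevel ε) ↔ d ≤ ε := by
  -- The complex at `ε` is already complete at the largest value of a simplex in it, so only
  -- finitely many parameters matter and a least one exists.
  have hval : ∀ ε, q (Φ.sublevel ε) → ∃ t ∈ Set.range Φ.val, t ≤ ε ∧ q (Φ.sublevel t) := by
    intro ε hε
    have hne : (Φ.sublevel ε).faces.Nonempty :=
      Set.nonempty_iff_ne_empty.2 fun h => hbot _ h hε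
    obtain ⟨σ, hσ, hmax⟩ := (Set.toFinite _).exists_maximalFor Φ.val _ hne
    refine ⟨_, ⟨σ, rfl⟩, hσ.2, hq _ _ (sublevel_le_sublevel fun τ hτ hτε => ?_) hε⟩
    by_contra hlt
    exact hlt (hmax ⟨hτ, hτε⟩ (le_of_not_ge hlt))
  by_cases hex : ∃ ε, q (Φ.sublevel ε)
  · obtain ⟨ε₀, hε₀⟩ := hex
    obtain ⟨t₀, ht₀, -, hqt₀⟩ := hval ε₀ hε₀
    obtain ⟨β, ⟨-, hβ⟩, hmin⟩ := Set.exists_min_image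
      {t | t ∈ Set.range Φ.val ∧ q (Φ.sublevel t)} id
      ((Set.finite_range Φ.val).subset fun t ht => ht.1) ⟨t₀, ht₀, hqt₀⟩
    refine ⟨β, fun ε => ⟨fun h => ?_, fun h => ?_⟩⟩
    · obtain ⟨t, ht, htε, hqt⟩ := hval ε h
      exact WithTop.coe_le_coe.2 ((hmin t ⟨ht, hqt⟩).trans htε)
    · exact hq _ _ (Φ.sublevel_mono (WithTop.coe_le_coe.1 h)) hβ
  · refine ⟨⊤, fun ε => ⟨fun h => (hex ⟨ε, h⟩).elim, fun h => ?_⟩⟩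
    exact absurd (top_le_iff.1 h) (WithTop.coe_ne_top)

theorem chains_eq_bot {L : PreAbstractSimplicialComplex X} (hL : L.faces = ∅) (n : ℕ) :
    chains F L n = ⊥ := by
  simp [chains, hL]

theorem cycles_le_chains (L : PreAbstractSimplicialComplex X) :
    ∀ n : ℕ, cycles F L n ≤ chains F L n
  | 0 => le_rfl
  | _ + 1 => inf_le_left

/-- The diagram read off from a basis adapted to the cycles and boundaries of all sublevel
complexes: the basis element `b i` is born at `β i` and dies at `d i`. -/
theorem exists_isDiagram_of_basis {ι : Type*} [Finite ι] (Φ : Filtration X) (k : ℕ)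
    (b : Module.Basis ι F (TupleSpace F X k))
    (hZ : ∀ ε, ∀ x ∈ cycles F (Φ.sublevel ε) k, ∀ i,
      b i ∉ cycles F (Φ.sublevel ε) k → b.repr x i = 0)
    (hB : ∀ ε, ∀ x ∈ boundaries F (Φ.sublevel ε) k, ∀ i,
      b i ∉ boundaries F (Φ.sublevel ε) k → b.repr x i = 0)
    (β d : ι → WithTop ℝ)
    (hβ : ∀ i (ε : ℝ), b i ∈ cycles F (Φ.sublevel ε) k ↔ β i ≤ ε)
    (hd : ∀ i (ε : ℝ), b i ∈ boundaries F (Φ.sublevel ε) k ↔ d i ≤ ε) :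
    ∃ (D : Multiset Point) (j : D → ι), Function.Injective j ∧
      (∀ a : D, (a.1.1 : WithTop ℝ) = β (j a) ∧ a.1.2 = d (j a)) ∧
      (∀ i, β i < d i → i ∈ Set.range j) ∧
      IsDiagram (Φ.persistentHomology F k) D := by
  classical
  have := Fintype.ofFinite ι
  -- Basis elements with an empty interval contribute no point.
  let κ := {i // β i < d i}
  let P : κ → Point := fun i => ((β i).untop (ne_top_of_lt i.2), d i)
  have hP : ∀ i : κ, ((P i).1 : WithTop ℝ) = β i := fun i => WithTop.coe_untop _ _
  obtain ⟨D, e, he⟩ : ∃ (D : Multiset Point) (e : D ≃ κ), ∀ a : D, P (e a) = a.1 := by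
    refine ⟨(Finset.univ : Finset κ).val.map P,
      ((Multiset.mapEquiv _ P).symm.trans (Equiv.ofBijective (fun a => a.1) ⟨?_, ?_⟩)), ?_⟩
    -- An element of a multiset, as a type, carries a copy number; in `Finset.univ` every
    -- multiplicity is one, so this number is determined.
    · rintro ⟨x, m⟩ ⟨y, n⟩ (rfl : x = y)
      have h1 : ∀ x : κ, (Finset.univ : Finset κ).val.count x = 1 := fun x =>
        Multiset.count_eq_one_of_mem Finset.univ.nodup (Finset.mem_univ x)
      have : m = n := by
        ext
        have hm := m.2.trans_eq (h1 x)
        have hn := n.2.trans_eq (h1 x)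
        omega
      rw [this]
    · intro x
      exact ⟨⟨x, ⟨0, Multiset.count_pos.2 (Finset.mem_univ x)⟩⟩, rfl⟩
    · intro a
      obtain ⟨a, rfl⟩ := (Multiset.mapEquiv _ P).surjective a
      simp only [Equiv.trans_apply, Equiv.symm_apply_apply, Multiset.mapEquiv_apply]
      rfl
  have halive : ∀ (a : D) (ε : ℝ), Point.Alive a.1 ε ↔
      b (e a) ∈ cycles F (Φ.sublevel ε) k ∧ b (e a) ∉ boundaries F (Φ.sublevel ε) k := by
    intro a ε
    rw [hβ, hd, ← hP, he, Point.Alive, WithTop.coe_le_coe, not_le]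
    conv_rhs => rw [show d (e a) = (P (e a)).2 from rfl, he]
  refine ⟨D, fun a => e a, fun a a' h => e.injective (Subtype.ext h), fun a => ?_, fun i hi => ?_,
    fun Q hQ => ?_, ?_⟩
  · rw [← hP, he]
    exact ⟨rfl, by rw [show d (e a) = (P (e a)).2 from rfl, he]⟩
  · exact ⟨e.symm ⟨i, hi⟩, by simp⟩
  · obtain ⟨a, rfl⟩ : ∃ a : D, a.1 = Q := ⟨⟨Q, ⟨0, Multiset.count_pos.2 hQ⟩⟩, rfl⟩
    rw [← he, hP]
    exact (e a).2
  let coord : ∀ ε, cycles F (Φ.sublevel ε) k →ₗ[F] ({a : D // Point.Alive a.1 ε} → F) := fun ε =>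
    (LinearMap.pi fun a => b.coord (e a.1)) ∘ₗ (cycles F (Φ.sublevel ε) k).subtype
  have hcoord : ∀ ε z a, coord ε z a = b.repr z.1 (e a.1) := fun _ _ _ => rfl
  have hsurj : ∀ ε, Function.Surjective (coord ε) := by
    intro ε y
    refine ⟨⟨∑ a : {a : D // Point.Alive a.1 ε}, y a • b (e a.1), ?_⟩, ?_⟩
    · exact sum_mem fun a _ => Submodule.smul_mem _ _ ((halive _ _).1 a.2).1
    · funext a
      rw [hcoord]
      simp only [map_sum, map_smul, Module.Basis.repr_self, Finsupp.coe_finsetSum,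
        Finset.sum_apply, Finsupp.smul_apply, Finsupp.single_apply, smul_eq_mul]
      rw [Finset.sum_eq_single a]
      · simp
      · intro c _ hca
        rw [if_neg, mul_zero]
        exact fun h => hca (Subtype.ext (e.injective (Subtype.ext h)))
      · simp
  -- In the expansion of a cycle only basis elements that are cycles occur; if the coordinates of
  -- the alive ones vanish, only boundaries are left.
  have hker : ∀ ε, (boundaries F (Φ.sublevel ε) k).submoduleOf (cycles F (Φ.sublevel ε) k) =
      LinearMap.ker (coord ε) := by
    intro ε
    ext z
    change z.1 ∈ boundaries F (Φ.sublevel ε) k ↔ coord ε z = 0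
    constructor
    · intro hz
      funext a
      exact hB ε _ hz _ ((halive _ _).1 a.2).2
    · intro hz
      rw [← b.sum_repr z.1]
      refine sum_mem fun i _ => ?_
      by_cases hiB : b i ∈ boundaries F (Φ.sublevel ε) k
      · exact Submodule.smul_mem _ _ hiB
      suffices b.repr z.1 i = 0 by simp [this]
      by_cases hiZ : b i ∈ cycles F (Φ.sublevel ε) k
      · have hlt : β i < d i := ((hβ _ _).1 hiZ).trans_lt (not_le.1 fun h => hiB ((hd _ _).2 h))
        have hei : ((e (e.symm ⟨i, hlt⟩) : κ) : ι) = i := by simp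
        have ha : Point.Alive (e.symm ⟨i, hlt⟩).1 ε := by
          rw [halive, hei]
          exact ⟨hiZ, hiB⟩
        have := congrFun hz ⟨_, ha⟩
        rwa [hcoord, hei] at this
      · exact hZ ε _ z.2 _ hiZ
  let E : ∀ ε, (Φ.persistentHomology F k).space ε ≃ₗ[F] (intervalSum F D).space ε := fun ε =>
    (Submodule.quotEquivOfEq _ _ (hker ε)).trans
      ((coord ε).quotKerEquivOfSurjective (hsurj ε))
  refine ⟨E, fun {ε ε'} h x => ?_⟩
  obtain ⟨z, rfl⟩ := Submodule.Quotient.mk_surjective _ x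
  have hE : ∀ ε (z : cycles F (Φ.sublevel ε) k), E ε (Submodule.Quotient.mk z) = coord ε z :=
    fun _ _ => rfl
  have hm : (Φ.persistentHomology F k).map h (Submodule.Quotient.mk z) =
      Submodule.Quotient.mk (Submodule.inclusion (cycles_mono (Φ.sublevel_mono h) k) z) := rfl
  rw [hm, hE, hE]
  funext a
  change b.repr z.1 (e a.1) = if ha : Point.Alive a.1.1 ε then b.repr z.1 (e a.1) else 0
  split_ifs with ha
  · rfl
  -- A point alive at `ε'` but not at `ε` is not yet born at `ε`, so it cannot occur in a cycle at
  -- `ε`.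
  · refine hZ ε _ z.2 _ fun hz => ha ((halive _ _).2 ⟨hz, fun hb => ?_⟩)
    exact ((halive _ _).1 a.2).2 (boundaries_mono (Φ.sublevel_mono h) k hb)

end Diagrams

/-! ### Uniqueness of diagrams -/

section Uniqueness

/-- `P` is alive throughout `[ε, ε']`. -/
def Point.AliveOn (P : Point) (ε ε' : ℝ) : Prop := P.1 ≤ ε ∧ (ε' : WithTop ℝ) < P.2

theorem Point.aliveOn_iff {P : Point} {ε ε' : ℝ} (h : ε ≤ ε') :
    P.AliveOn ε ε' ↔ P.Alive ε ∧ P.Alive ε' :=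
  ⟨fun hP => ⟨⟨hP.1, (WithTop.coe_le_coe.2 h).trans_lt hP.2⟩, hP.1.trans h, hP.2⟩,
    fun hP => ⟨hP.1.1, hP.2.2⟩⟩

variable {F : Type*} [Field F]

-- The image consists of the functions supported on the points alive at both ends, parametrized by
-- extension by zero. This turns multiplicities into an isomorphism invariant.
open Classical in
theorem finrank_range_intervalSum_map (D : Multiset Point) {ε ε' : ℝ} (h : ε ≤ ε') :
    Module.finrank F (LinearMap.range ((intervalSum F D).map h)) =
      D.countP fun P => P.AliveOn ε ε' := by
  let S := {a : D // a.1.AliveOn ε ε'}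
  let ext : (S → F) →ₗ[F] ({a : D // Point.Alive a.1 ε'} → F) :=
    { toFun := fun x a => if ha : a.1.1.AliveOn ε ε' then x ⟨a.1, ha⟩ else 0
      map_add' := fun x y => by
        funext a
        by_cases ha : a.1.1.AliveOn ε ε' <;> simp [ha]
      map_smul' := fun c x => by
        funext a
        by_cases ha : a.1.1.AliveOn ε ε' <;> simp [ha] }
  have hinj : Function.Injective ext := by
    intro x y hxy
    funext a
    have := congrFun hxy ⟨a.1, ((Point.aliveOn_iff h).1 a.2).2⟩
    simpa [ext, a.2] using this
  have hrange : LinearMap.range ((intervalSum F D).map h) = LinearMap.range ext := by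
    ext y
    constructor
    · rintro ⟨x, rfl⟩
      refine ⟨fun a => x ⟨a.1, ((Point.aliveOn_iff h).1 a.2).1⟩, ?_⟩
      funext a
      change (if ha : a.1.1.AliveOn ε ε' then x ⟨a.1, _⟩ else 0) =
        if ha : Point.Alive a.1.1 ε then x ⟨a.1, ha⟩ else 0
      by_cases ha : Point.Alive a.1.1 ε
      · simp [ha, (Point.aliveOn_iff h).2 ⟨ha, a.2⟩]
      · simp [ha, Point.aliveOn_iff h]
    · rintro ⟨x, rfl⟩
      refine ⟨fun a => if ha : a.1.1.AliveOn ε ε' then x ⟨a.1, ha⟩ else 0, ?_⟩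
      funext a
      change (if ha : Point.Alive a.1.1 ε then
        (if ha : a.1.1.AliveOn ε ε' then x ⟨a.1, ha⟩ else 0) else 0) =
        (if ha : a.1.1.AliveOn ε ε' then x ⟨a.1, ha⟩ else 0)
      by_cases ha : Point.Alive a.1.1 ε
      · simp [ha]
      · simp [ha, Point.aliveOn_iff h]
  have hfin : Module.finrank F (LinearMap.range ext) = Fintype.card S :=
    (LinearMap.finrank_range_of_inj hinj).trans (Module.finrank_fintype_fun_eq_card F)
  rw [hrange]
  refine hfin.trans ?_
  rw [Fintype.card_subtype]
  conv_rhs => rw [← D.map_univ_coe, Multiset.countP_map]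
  rfl

theorem PersistenceModule.Isomorphic.symm {V W : PersistenceModule F} (h : V.Isomorphic W) :
    W.Isomorphic V := by
  obtain ⟨e, he⟩ := h
  refine ⟨fun ε => (e ε).symm, fun h x => ?_⟩
  rw [LinearEquiv.symm_apply_eq, he]
  simp

theorem PersistenceModule.Isomorphic.trans {U V W : PersistenceModule F} (h : U.Isomorphic V)
    (h' : V.Isomorphic W) : U.Isomorphic W := by
  obtain ⟨e, he⟩ := h
  obtain ⟨e', he'⟩ := h'
  exact ⟨fun ε => (e ε).trans (e' ε), fun h x => by simp [he, he']⟩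

theorem IsDiagram.of_isomorphic {V W : PersistenceModule F} {D : Multiset Point}
    (hD : IsDiagram W D) (h : V.Isomorphic W) : IsDiagram V D :=
  ⟨hD.1, h.trans hD.2⟩

theorem PersistenceModule.Isomorphic.finrank_range_map {V W : PersistenceModule F}
    (h : V.Isomorphic W) {ε ε' : ℝ} (hε : ε ≤ ε') :
    Module.finrank F (LinearMap.range (V.map hε)) =
      Module.finrank F (LinearMap.range (W.map hε)) := by
  obtain ⟨e, he⟩ := h
  have : LinearMap.range (W.map hε) = (LinearMap.range (V.map hε)).map (e ε').toLinearMap := by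
    ext y
    constructor
    · rintro ⟨x, rfl⟩
      exact ⟨V.map hε ((e ε).symm x), ⟨_, rfl⟩, by simp [he]⟩
    · rintro ⟨_, ⟨x, rfl⟩, rfl⟩
      exact ⟨e ε x, (he hε x).symm⟩
  rw [this]
  exact (LinearEquiv.finrank_map_eq (e ε') _).symm

open Classical in
/-- A diagram is determined by the numbers of its points that are alive throughout `[ε, ε']`. -/
theorem eq_of_countP_aliveOn_eq {D D' : Multiset Point}
    (hD : ∀ P ∈ D, (P.1 : WithTop ℝ) < P.2) (hD' : ∀ P ∈ D', (P.1 : WithTop ℝ) < P.2)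
    (h : ∀ ε ε' : ℝ, ε ≤ ε' →
      D.countP (fun P => P.AliveOn ε ε') = D'.countP (fun P => P.AliveOn ε ε')) : D = D' := by
  have key : ∀ {D D' : Multiset Point} (h : ∀ ε ε' : ℝ, ε ≤ ε' →
      D.countP (fun P => P.AliveOn ε ε') = D'.countP (fun P => P.AliveOn ε ε')),
      ∀ P ∈ D, ∀ ε ε' : ℝ, ε ≤ ε' → P.AliveOn ε ε' → ∃ Q ∈ D', Q.AliveOn ε ε' := by
    intro D D' h P hP ε ε' hε hPε
    rw [← Multiset.countP_pos, ← h _ _ hε]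
    exact Multiset.countP_pos.2 ⟨P, hP, hPε⟩
  induction hn : D.card generalizing D D' with
  | zero =>
    rw [Multiset.card_eq_zero] at hn
    subst hn
    refine (Multiset.eq_zero_of_forall_notMem fun P hP => ?_).symm
    obtain ⟨Q, hQ, -⟩ := key (fun ε ε' hε => (h ε ε' hε).symm) P hP P.1 P.1 le_rfl
      ⟨le_rfl, hD' P hP⟩
    simp at hQ
  | succ n ih =>
    -- the earliest births agree, and among these the latest deaths
    have hne : D.toFinset.Nonempty := by
      rw [Multiset.toFinset_nonempty]
      rintro rfl
      simp at hn
    obtain ⟨P₀, hP₀, hmin⟩ := D.toFinset.exists_min_image Prod.fst hne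
    rw [Multiset.mem_toFinset] at hP₀
    replace hmin : ∀ Q ∈ D, P₀.1 ≤ Q.1 := fun Q hQ => hmin Q (Multiset.mem_toFinset.2 hQ)
    have hmin' : ∀ Q ∈ D', P₀.1 ≤ Q.1 := by
      intro Q hQ
      obtain ⟨R, hR, hRQ⟩ := key (fun ε ε' hε => (h ε ε' hε).symm) Q hQ Q.1 Q.1 le_rfl
        ⟨le_rfl, hD' Q hQ⟩
      exact (hmin R hR).trans hRQ.1
    obtain ⟨P, hP, hmax⟩ := (D.toFinset.filter fun Q => Q.1 = P₀.1).exists_max_image Prod.snd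
      ⟨P₀, by simp [hP₀]⟩
    simp only [Finset.mem_filter, Multiset.mem_toFinset] at hP hmax
    obtain ⟨Q₀, hQ₀, hQ₀P⟩ := key h P₀ hP₀ P₀.1 P₀.1 le_rfl ⟨le_rfl, hD P₀ hP₀⟩
    obtain ⟨Q, hQ, hmaxQ⟩ := (D'.toFinset.filter fun Q => Q.1 = P₀.1).exists_max_image Prod.snd
      ⟨Q₀, by simp [hQ₀, le_antisymm hQ₀P.1 (hmin' Q₀ hQ₀)]⟩
    simp only [Finset.mem_filter, Multiset.mem_toFinset] at hQ hmaxQ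
    have hle : ∀ {D D' : Multiset Point} {P Q : Point} (_ : ∀ ε ε' : ℝ, ε ≤ ε' →
        D.countP (fun P => P.AliveOn ε ε') = D'.countP (fun P => P.AliveOn ε ε'))
        (_ : ∀ Q ∈ D', P₀.1 ≤ Q.1) (_ : P ∈ D) (_ : P.1 = P₀.1)
        (_ : (P.1 : WithTop ℝ) < P.2) (_ : Q.1 = P₀.1) (_ : (Q.1 : WithTop ℝ) < Q.2)
        (_ : ∀ R : Point, R ∈ D' ∧ R.1 = P₀.1 → R.2 ≤ Q.2), P.2 ≤ Q.2 := by
      intro D D' P Q h hmin' hP hP1 _ hQ1 hQ12 hmaxQ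
      by_contra hlt
      rw [not_le] at hlt
      obtain ⟨q, hq⟩ := WithTop.ne_top_iff_exists.1 (ne_top_of_lt hlt)
      rw [← hq, WithTop.coe_lt_coe, hQ1] at hQ12
      -- Intervals are half-open, so a point alive at `q`, the death of `Q`, dies strictly later
      -- than `Q`; as no birth precedes `P₀.1`, this contradicts the choice of `Q`.
      obtain ⟨R, hR, hRq⟩ := key h P hP P₀.1 q hQ12.le ⟨hP1.le, hq ▸ hlt⟩
      have := hmaxQ R ⟨hR, le_antisymm hRq.1 (hmin' R hR)⟩
      rw [← hq] at this
      exact this.not_gt hRq.2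
    have hPQ : P = Q := Prod.ext (hP.2.trans hQ.2.symm) (le_antisymm
      (hle h hmin' hP.1 hP.2 (hD P hP.1) hQ.2 (hD' Q hQ.1) hmaxQ)
      (hle (fun ε ε' hε => (h ε ε' hε).symm) hmin hQ.1 hQ.2 (hD' Q hQ.1) hP.2 (hD P hP.1) hmax))
    subst hPQ
    obtain ⟨E, rfl⟩ := Multiset.exists_cons_of_mem hP.1
    obtain ⟨E', rfl⟩ := Multiset.exists_cons_of_mem hQ.1
    congr 1
    refine ih (fun R hR => hD R (Multiset.mem_cons_of_mem hR))
      (fun R hR => hD' R (Multiset.mem_cons_of_mem hR)) (fun ε ε' hε => ?_) (by simpa using hn)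
    have := h ε ε' hε
    rwa [Multiset.countP_cons, Multiset.countP_cons, Nat.add_right_cancel_iff] at this

theorem IsDiagram.unique {V : PersistenceModule F} {D D' : Multiset Point} (hD : IsDiagram V D)
    (hD' : IsDiagram V D') : D = D' := by
  refine eq_of_countP_aliveOn_eq hD.1 hD'.1 fun ε ε' hε => ?_
  rw [← finrank_range_intervalSum_map (F := F) D hε, ← finrank_range_intervalSum_map (F := F) D' hε]
  exact (hD.2.symm.trans hD'.2).finrank_range_map hε

end Uniqueness

/-! ### Partial matchings -/

section Matchings

theorem extDist_comm : ∀ x y : WithTop ℝ, extDist x y = extDist y x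
  | some x, some y => by simp only [extDist, abs_sub_comm]
  | none, none => rfl
  | none, some _ => rfl
  | some _, none => rfl

theorem extDist_self : ∀ x : WithTop ℝ, extDist x x = 0
  | some x => by simp [extDist]
  | none => rfl

theorem extDist_triangle : ∀ x y z : WithTop ℝ, extDist x z ≤ extDist x y + extDist y z
  | some x, some y, some z => by
    simp only [extDist]
    rw [← ENNReal.ofReal_add (abs_nonneg _) (abs_nonneg _)]
    exact ENNReal.ofReal_le_ofReal (abs_sub_le x y z)
  | none, none, none => by simp [extDist]
  | none, none, some _ => by simp [extDist]
  | none, some _, none => by simp [extDist]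
  | none, some _, some _ => by simp [extDist]
  | some _, none, none => by simp [extDist]
  | some _, none, some _ => by simp [extDist]
  | some _, some _, none => by simp [extDist]

/-- The hypotheses have the form that inclusions of sublevel complexes with shift `δ` give for
births and deaths; they force both values to be finite or both infinite. -/
theorem extDist_le_ofReal {x y : WithTop ℝ} {δ : ℝ}
    (hxy : ∀ ε : ℝ, x ≤ ε → y ≤ (ε + δ : ℝ)) (hyx : ∀ ε : ℝ, y ≤ ε → x ≤ (ε + δ : ℝ)) :
    extDist x y ≤ ENNReal.ofReal δ := by
  induction x with
  | top =>
    induction y with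
    | top => exact (extDist_self ⊤).trans_le zero_le
    | coe y => exact absurd (hyx y le_rfl) (by simp)
  | coe x =>
    induction y with
    | top => exact absurd (hxy x le_rfl) (by simp)
    | coe y =>
      have h1 := WithTop.coe_le_coe.1 (hxy x le_rfl)
      have h2 := WithTop.coe_le_coe.1 (hyx y le_rfl)
      exact ENNReal.ofReal_le_ofReal (abs_le.2 ⟨by linarith, by linarith⟩)

theorem Point.supDist_triangle (P Q R : Point) :
    P.supDist R ≤ P.supDist Q + Q.supDist R :=
  max_le ((extDist_triangle _ _ _).trans (add_le_add (le_max_left _ _) (le_max_left _ _)))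
    ((extDist_triangle _ _ _).trans (add_le_add (le_max_right _ _) (le_max_right _ _)))

theorem Point.supDist_comm (P Q : Point) : P.supDist Q = Q.supDist P := by
  rw [Point.supDist, Point.supDist, extDist_comm, extDist_comm P.2]

theorem extDist_div_two_le {x y x' y' : WithTop ℝ} {r s : ℝ≥0∞}
    (hx : extDist x x' ≤ r) (hy : extDist y y' ≤ r) (h : extDist x' y' / 2 ≤ s) :
    extDist x y / 2 ≤ r + s := by
  have h2 : (2 : ℝ≥0∞) ≠ 0 := two_ne_zero
  rw [ENNReal.div_le_iff h2 ENNReal.ofNat_ne_top] at h ⊢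
  calc extDist x y ≤ extDist x x' + (extDist x' y' + extDist y' y) :=
        (extDist_triangle _ _ _).trans (add_le_add_right (extDist_triangle _ _ _) _)
    _ ≤ r + (s * 2 + r) := by
        rw [extDist_comm y' y]
        gcongr
    _ = (r + s) * 2 := by ring

theorem Point.pers_div_two_le {P Q : Point} {r s : ℝ≥0∞} (h : P.supDist Q ≤ r)
    (hQ : Q.pers / 2 ≤ s) : P.pers / 2 ≤ r + s :=
  extDist_div_two_le ((le_max_right _ _).trans h) ((le_max_left _ _).trans h) hQ

/-- A relation between the points of two diagrams that is a partial matching of cost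
at most `r`. -/
structure IsMatching {D₁ D₂ : Multiset Point} (R : D₁ → D₂ → Prop) (r : ℝ≥0∞) : Prop where
  right_unique : ∀ a b b', R a b → R a b' → b = b'
  left_unique : ∀ a a' b, R a b → R a' b → a = a'
  supDist_le : ∀ a b, R a b → Point.supDist a.1 b.1 ≤ r
  pers_left_le : ∀ a, (∀ b, ¬ R a b) → Point.pers a.1 / 2 ≤ r
  pers_right_le : ∀ b, (∀ a, ¬ R a b) → Point.pers b.1 / 2 ≤ r

/-- The diagrams have a partial matching of cost at most `r`. -/
def Matched (D₁ D₂ : Multiset Point) (r : ℝ≥0∞) : Prop :=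
  ∃ R : D₁ → D₂ → Prop, IsMatching R r

theorem Matched.symm {D₁ D₂ : Multiset Point} {r : ℝ≥0∞} (h : Matched D₁ D₂ r) :
    Matched D₂ D₁ r := by
  obtain ⟨R, hR⟩ := h
  exact ⟨fun b a => R a b, fun b a a' => hR.left_unique a a' b,
    fun b b' a => hR.right_unique a b b',
    fun b a hab => (Point.supDist_comm _ _).trans_le (hR.supDist_le a b hab),
    hR.pers_right_le, hR.pers_left_le⟩

/-- The relations are composed. A point whose partner stays unmatched in the other step is covered
because half the persistence changes by no more than the endpoints do. -/
theorem Matched.trans {D₁ D₂ D₃ : Multiset Point} {r s : ℝ≥0∞} (h : Matched D₁ D₂ r)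
    (h' : Matched D₂ D₃ s) : Matched D₁ D₃ (r + s) := by
  obtain ⟨R, hR⟩ := h
  obtain ⟨S, hS⟩ := h'
  refine ⟨fun a c => ∃ b, R a b ∧ S b c, ?_, ?_, ?_, ?_, ?_⟩
  · rintro a c c' ⟨b, hab, hbc⟩ ⟨b', hab', hbc'⟩
    obtain rfl := hR.right_unique _ _ _ hab hab'
    exact hS.right_unique _ _ _ hbc hbc'
  · rintro a a' c ⟨b, hab, hbc⟩ ⟨b', hab', hbc'⟩
    obtain rfl := hS.left_unique _ _ _ hbc hbc'
    exact hR.left_unique _ _ _ hab hab'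
  · rintro a c ⟨b, hab, hbc⟩
    exact (Point.supDist_triangle _ _ _).trans
      (add_le_add (hR.supDist_le _ _ hab) (hS.supDist_le _ _ hbc))
  · intro a ha
    by_cases hex : ∃ b, R a b
    · obtain ⟨b, hab⟩ := hex
      exact Point.pers_div_two_le (hR.supDist_le _ _ hab)
        (hS.pers_left_le b fun c hbc => ha c ⟨b, hab, hbc⟩)
    · exact (hR.pers_left_le a fun b hab => hex ⟨b, hab⟩).trans le_self_add
  · intro c hc
    by_cases hex : ∃ b, S b c
    · obtain ⟨b, hbc⟩ := hex
      rw [add_comm]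
      exact Point.pers_div_two_le ((Point.supDist_comm _ _).trans_le (hS.supDist_le _ _ hbc))
        (hR.pers_right_le b fun a hab => hc a ⟨b, hab, hbc⟩)
    · exact (hS.pers_right_le c fun b hbc => hex ⟨b, hbc⟩).trans le_add_self

theorem Matched.bottleneckDist_le {D₁ D₂ : Multiset Point} {r : ℝ≥0∞} (h : Matched D₁ D₂ r) :
    bottleneckDist D₁ D₂ ≤ r := by
  obtain ⟨R, hR⟩ := h
  let B₁ : Set D₁ := {a | ∃ b, R a b}
  let B₂ : Set D₂ := {b | ∃ a, R a b}
  let φ : B₁ ≃ B₂ := Equiv.ofBijective (fun a => ⟨a.2.choose, a.1, a.2.choose_spec⟩) ⟨by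
    intro a a' haa'
    have : a.2.choose = a'.2.choose := congrArg Subtype.val haa'
    exact Subtype.ext (hR.left_unique _ _ _ a.2.choose_spec (this ▸ a'.2.choose_spec)), by
    rintro ⟨b, a, hab⟩
    refine ⟨⟨a, b, hab⟩, Subtype.ext ?_⟩
    exact hR.right_unique _ _ _ (Exists.choose_spec (⟨b, hab⟩ : ∃ b, R a b)) hab⟩
  unfold bottleneckDist
  refine iInf_le_of_le B₁ (iInf_le_of_le B₂ (iInf_le_of_le φ ?_))
  refine sup_le (sup_le (iSup_le fun a => ?_) (iSup_le fun a => ?_)) (iSup_le fun b => ?_)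
  · exact hR.supDist_le _ _ a.2.choose_spec
  · exact hR.pers_left_le _ fun b hab => a.2 ⟨b, hab⟩
  · exact hR.pers_right_le _ fun a hab => b.2 ⟨a, hab⟩

end Matchings

/-! ### Comparable filtrations -/

section Comparable

variable {F : Type*} [Field F] {X : Type*}

/-- No two simplices enter the two filtrations in opposite orders. -/
def Filtration.Comparable (Φ Ψ : Filtration X) : Prop :=
  ∀ σ τ, Φ.val σ < Φ.val τ → Ψ.val σ ≤ Ψ.val τ

/-- If a complex of `Φ` and one of `Ψ` were incomparable, a simplex from each difference would give
a pair entering in opposite orders. -/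
theorem Filtration.Comparable.isChain {Φ Ψ : Filtration X} (h : Φ.Comparable Ψ) :
    IsChain (· ≤ ·) (Set.range Φ.sublevel ∪ Set.range Ψ.sublevel) := by
  have hself : ∀ (Φ : Filtration X) ε ε',
      Φ.sublevel ε ≤ Φ.sublevel ε' ∨ Φ.sublevel ε' ≤ Φ.sublevel ε := fun Φ ε ε' =>
    (le_total ε ε').imp (fun h => Φ.sublevel_mono h) (fun h => Φ.sublevel_mono h)
  have hmix : ∀ ε ε', Φ.sublevel ε ≤ Ψ.sublevel ε' ∨ Ψ.sublevel ε' ≤ Φ.sublevel ε := by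
    intro ε ε'
    by_contra! hne
    obtain ⟨σ, hσ, hσ'⟩ := Set.not_subset.1 hne.1
    obtain ⟨τ, hτ, hτ'⟩ := Set.not_subset.1 hne.2
    have h1 : Φ.val τ > ε := not_le.1 fun h => hτ' ⟨hτ.1, h⟩
    have h2 : Ψ.val σ > ε' := not_le.1 fun h => hσ' ⟨hσ.1, h⟩
    exact (((hτ.2.trans_lt h2).trans_le (h σ τ (hσ.2.trans_lt h1)))).false
  rintro _ (⟨ε, rfl⟩ | ⟨ε, rfl⟩) _ (⟨ε', rfl⟩ | ⟨ε', rfl⟩) -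
  exacts [hself _ _ _, hmix _ _, (hmix _ _).symm, hself _ _ _]

/-- Diagrams whose points are indexed by a common family of possibly degenerate intervals are
matched along the common index. -/
theorem matched_of_index {ι : Type*} {β₁ d₁ β₂ d₂ : ι → WithTop ℝ} (hle₁ : ∀ i, β₁ i ≤ d₁ i)
    (hle₂ : ∀ i, β₂ i ≤ d₂ i) {r : ℝ≥0∞} (hβ : ∀ i, extDist (β₁ i) (β₂ i) ≤ r)
    (hd : ∀ i, extDist (d₁ i) (d₂ i) ≤ r) {D₁ D₂ : Multiset Point} {j₁ : D₁ → ι} {j₂ : D₂ → ι}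
    (hj₁ : Function.Injective j₁) (hj₂ : Function.Injective j₂)
    (hval₁ : ∀ a : D₁, (a.1.1 : WithTop ℝ) = β₁ (j₁ a) ∧ a.1.2 = d₁ (j₁ a))
    (hval₂ : ∀ a : D₂, (a.1.1 : WithTop ℝ) = β₂ (j₂ a) ∧ a.1.2 = d₂ (j₂ a))
    (hex₁ : ∀ i, β₁ i < d₁ i → i ∈ Set.range j₁)
    (hex₂ : ∀ i, β₂ i < d₂ i → i ∈ Set.range j₂) : Matched D₁ D₂ r := by
  refine ⟨fun a a' => j₁ a = j₂ a', fun a a' a'' h h' => hj₂ (h.symm.trans h'),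
    fun a a' a'' h h' => hj₁ (h.trans h'.symm), fun a a' haa' => ?_, fun a ha => ?_,
    fun a ha => ?_⟩
  · rw [Point.supDist, (hval₁ a).1, (hval₁ a).2, (hval₂ a').1, (hval₂ a').2, haa']
    exact max_le (hβ _) (hd _)
  -- The interval with the same index is degenerate on the other side, so both ends of `a` are
  -- within `r` of one value.
  · have heq : β₂ (j₁ a) = d₂ (j₁ a) := by
      by_contra hne
      obtain ⟨a', ha'⟩ := hex₂ _ (lt_of_le_of_ne (hle₂ _) hne)
      exact ha a' ha'.symm
    rw [Point.pers, (hval₁ a).1, (hval₁ a).2, ← add_zero r]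
    exact extDist_div_two_le (hd _) (hβ _) (by rw [heq, extDist_self]; simp)
  · have heq : β₁ (j₂ a) = d₁ (j₂ a) := by
      by_contra hne
      obtain ⟨a', ha'⟩ := hex₁ _ (lt_of_le_of_ne (hle₁ _) hne)
      exact ha a' ha'
    rw [Point.pers, (hval₂ a).1, (hval₂ a).2, ← add_zero r]
    exact extDist_div_two_le ((extDist_comm _ _).trans_le (hd _))
      ((extDist_comm _ _).trans_le (hβ _)) (by rw [heq, extDist_self]; simp)

/-- A nonzero chain does not lie in the empty complex, which excludes a threshold at `-∞`; the value
`⊤` stands for never. Birth precedes death since boundaries are cycles. -/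
theorem Filtration.exists_birth_death [Finite X] (Φ : Filtration X) (k : ℕ)
    {x : TupleSpace F X k} (hx : x ≠ 0) :
    ∃ β d : WithTop ℝ, β ≤ d ∧ (∀ ε : ℝ, x ∈ cycles F (Φ.sublevel ε) k ↔ β ≤ ε) ∧
      ∀ ε : ℝ, x ∈ boundaries F (Φ.sublevel ε) k ↔ d ≤ ε := by
  obtain ⟨β, hβ⟩ := Φ.exists_threshold (fun L => x ∈ cycles F L k)
    (fun _ _ hL h => cycles_mono hL k h) fun L hL h => hx <| by
      have := cycles_le_chains L k h
      rwa [chains_eq_bot hL] at this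
  obtain ⟨d, hd⟩ := Φ.exists_threshold (fun L => x ∈ boundaries F L k)
    (fun _ _ hL h => boundaries_mono hL k h) fun L hL h => hx <| by
      rwa [boundaries, chains_eq_bot hL, Submodule.map_bot] at h
  exact ⟨β, d, WithTop.forall_le_coe_iff_le.1 fun ε hε =>
    (hβ ε).1 (boundaries_le_cycles _ k ((hd ε).2 hε)), hβ, hd⟩

theorem Filtration.Comparable.exists_basis [Finite X] {Φ Ψ : Filtration X}
    (h : Φ.Comparable Ψ) (F : Type*) [Field F] (k : ℕ) :
    ∃ (S : Set (TupleSpace F X k)) (b : Module.Basis S F (TupleSpace F X k)), Finite S ∧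
      ∀ Θ : Filtration X, Θ = Φ ∨ Θ = Ψ → ∀ ε,
        (∀ x ∈ cycles F (Θ.sublevel ε) k, ∀ i, b i ∉ cycles F (Θ.sublevel ε) k →
          b.repr x i = 0) ∧
        (∀ x ∈ boundaries F (Θ.sublevel ε) k, ∀ i, b i ∉ boundaries F (Θ.sublevel ε) k →
          b.repr x i = 0) := by
  have : Module.Finite F (TupleSpace F X k) :=
    inferInstanceAs (Module.Finite F ((Fin (k + 1) → X) →₀ F))
  obtain ⟨S, b, hb⟩ := exists_basis_adapted
    (h.isChain.image_of_map_rel _ (· ≤ ·) (fun L => cycles F L k) fun _ _ h => cycles_mono h k)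
    (h.isChain.image_of_map_rel _ (· ≤ ·) (fun L => boundaries F L k)
      fun _ _ h => boundaries_mono h k)
  refine ⟨S, b, Module.Finite.finite_basis b, fun Θ hΘ ε => ?_⟩
  have hmem : Θ.sublevel ε ∈ Set.range Φ.sublevel ∪ Set.range Ψ.sublevel := by
    rcases hΘ with rfl | rfl
    exacts [Or.inl ⟨ε, rfl⟩, Or.inr ⟨ε, rfl⟩]
  exact ⟨hb _ (Or.inl ⟨_, hmem, rfl⟩), hb _ (Or.inr ⟨_, hmem, rfl⟩)⟩

/-- One basis serves both filtrations, so its index set matches the two diagrams; `δ` enters only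
through the shifted inclusions of sublevel complexes. -/
theorem Filtration.Comparable.exists_matched [Finite X] {Φ Ψ : Filtration X}
    (h : Φ.Comparable Ψ) {δ : ℝ} (hδ : ∀ σ : Finset X, σ.Nonempty → |Φ.val σ - Ψ.val σ| ≤ δ)
    (F : Type*) [Field F] (k : ℕ) :
    ∃ D₁ D₂ : Multiset Point, IsDiagram (Φ.persistentHomology F k) D₁ ∧
      IsDiagram (Ψ.persistentHomology F k) D₂ ∧ Matched D₁ D₂ (ENNReal.ofReal δ) := by
  obtain ⟨S, b, hS, hb⟩ := h.exists_basis F k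
  choose β₁ d₁ hle₁ hβ₁ hd₁ using fun i => Φ.exists_birth_death k (b.ne_zero i)
  choose β₂ d₂ hle₂ hβ₂ hd₂ using fun i => Ψ.exists_birth_death k (b.ne_zero i)
  obtain ⟨D₁, j₁, hj₁, hval₁, hex₁, hD₁⟩ := exists_isDiagram_of_basis Φ k b
    (fun ε => (hb Φ (Or.inl rfl) ε).1) (fun ε => (hb Φ (Or.inl rfl) ε).2) β₁ d₁ hβ₁ hd₁
  obtain ⟨D₂, j₂, hj₂, hval₂, hex₂, hD₂⟩ := exists_isDiagram_of_basis Ψ k b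
    (fun ε => (hb Ψ (Or.inr rfl) ε).1) (fun ε => (hb Ψ (Or.inr rfl) ε).2) β₂ d₂ hβ₂ hd₂
  have hΦΨ : ∀ ε, Φ.sublevel ε ≤ Ψ.sublevel (ε + δ) := fun ε =>
    Filtration.sublevel_le_sublevel fun σ hσ h => by linarith [(abs_le.1 (hδ σ hσ)).1]
  have hΨΦ : ∀ ε, Ψ.sublevel ε ≤ Φ.sublevel (ε + δ) := fun ε =>
    Filtration.sublevel_le_sublevel fun σ hσ h => by linarith [(abs_le.1 (hδ σ hσ)).2]
  refine ⟨D₁, D₂, hD₁, hD₂, matched_of_index hle₁ hle₂ (fun i => extDist_le_ofReal ?_ ?_)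
    (fun i => extDist_le_ofReal ?_ ?_) hj₁ hj₂ hval₁ hval₂ hex₁ hex₂⟩
  · exact fun ε hε => (hβ₂ i _).1 (cycles_mono (hΦΨ ε) k ((hβ₁ i _).2 hε))
  · exact fun ε hε => (hβ₁ i _).1 (cycles_mono (hΨΦ ε) k ((hβ₂ i _).2 hε))
  · exact fun ε hε => (hd₂ i _).1 (boundaries_mono (hΦΨ ε) k ((hd₁ i _).2 hε))
  · exact fun ε hε => (hd₁ i _).1 (boundaries_mono (hΨΦ ε) k ((hd₂ i _).2 hε))

theorem Filtration.exists_isDiagram [Finite X] (Φ : Filtration X) (F : Type*) [Field F] (k : ℕ) :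
    ∃ D : Multiset Point, IsDiagram (Φ.persistentHomology F k) D := by
  obtain ⟨D, -, hD, -⟩ := Filtration.Comparable.exists_matched (Φ := Φ) (Ψ := Φ)
    (fun _ _ h => h.le) (δ := 0) (by simp) F k
  exact ⟨D, hD⟩

end Comparable

/-! ### Stability under perturbations of the filtration -/

section Stability

/-- A transitive relation on an interval that holds locally holds between the end points. -/
theorem rel_of_locally {a b : ℝ} (hab : a ≤ b) {r : ℝ → ℝ → Prop}
    (htrans : ∀ s t u, s ≤ t → t ≤ u → r s t → r t u → r s u)
    (hloc : ∀ t ∈ Set.Icc a b, ∀ᶠ s in nhds t, s ∈ Set.Icc a b →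
      (s ≤ t → r s t) ∧ (t ≤ s → r t s)) : r a b := by
  let S := {t | t ∈ Set.Icc a b ∧ r a t}
  have hbdd : BddAbove S := ⟨b, fun t ht => ht.1.2⟩
  have haS : a ∈ S :=
    ⟨⟨le_rfl, hab⟩, ((hloc a ⟨le_rfl, hab⟩).self_of_nhds ⟨le_rfl, hab⟩).1 le_rfl⟩
  have hc : sSup S ∈ Set.Icc a b := ⟨le_csSup hbdd haS, csSup_le ⟨a, haS⟩ fun t ht => ht.1.2⟩
  obtain ⟨η, hη, hball⟩ := Metric.eventually_nhds_iff.1 (hloc _ hc)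
  obtain ⟨t, ht, htc⟩ := exists_lt_of_lt_csSup ⟨a, haS⟩ (sub_lt_self (sSup S) hη)
  have htle := le_csSup hbdd ht
  have hac : r a (sSup S) := htrans _ _ _ ht.1.1 htle ht.2
    ((hball (by rw [Real.dist_eq, abs_lt]; constructor <;> linarith) ht.1).1 htle)
  rcases hc.2.eq_or_lt with h | h
  · rwa [h] at hac
  -- Locality at the supremum also reaches beyond it, which is absurd unless the supremum is `b`.
  · have hlt : sSup S < min b (sSup S + η / 2) := lt_min h (by linarith)
    have hle : min b (sSup S + η / 2) ≤ sSup S + η / 2 := min_le_right _ _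
    have hmem : min b (sSup S + η / 2) ∈ Set.Icc a b := ⟨hc.1.trans hlt.le, min_le_left _ _⟩
    have := le_csSup hbdd (show min b (sSup S + η / 2) ∈ S from ⟨hmem, htrans _ _ _ hc.1 hlt.le hac
      ((hball (by rw [Real.dist_eq, abs_lt]; constructor <;> linarith) hmem).2 hlt.le)⟩)
    exact absurd this hlt.not_ge

variable {F : Type*} [Field F] {X : Type*}

/-- The filtration `(1 - t) Φ + t Ψ`. -/
def Filtration.interpolate (Φ Ψ : Filtration X) (t : ℝ) (ht : t ∈ Set.Icc (0 : ℝ) 1) :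
    Filtration X where
  val σ := (1 - t) * Φ.val σ + t * Ψ.val σ
  mono := fun _ _ h => add_le_add (mul_le_mul_of_nonneg_left (Φ.mono h) (sub_nonneg.2 ht.2))
    (mul_le_mul_of_nonneg_left (Ψ.mono h) ht.1)

/-- The finitely many strict inequalities at `t` persist nearby by continuity; ties at `t` may break
either way. -/
theorem Filtration.eventually_comparable [Finite X] (Φ Ψ : Filtration X) (t : ℝ)
    (ht : t ∈ Set.Icc (0 : ℝ) 1) :
    ∀ᶠ s in nhds t, ∀ hs, (Φ.interpolate Ψ t ht).Comparable (Φ.interpolate Ψ s hs) := by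
  have hev : ∀ σ τ, ∀ᶠ s in nhds t, ∀ hs,
      (Φ.interpolate Ψ t ht).val σ < (Φ.interpolate Ψ t ht).val τ →
      (Φ.interpolate Ψ s hs).val σ ≤ (Φ.interpolate Ψ s hs).val τ := by
    intro σ τ
    by_cases hlt : (Φ.interpolate Ψ t ht).val σ < (Φ.interpolate Ψ t ht).val τ
    · have hcont : ∀ σ, Continuous fun s : ℝ => (1 - s) * Φ.val σ + s * Ψ.val σ := by
        intro σ
        fun_prop
      filter_upwards [(hcont σ).continuousAt.eventually_lt (hcont τ).continuousAt hlt] with s hs _ _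
      exact hs.le
    · exact Filter.Eventually.of_forall fun s hs h => absurd h hlt
  have : ∀ᶠ s in nhds t, ∀ σ τ, ∀ hs,
      (Φ.interpolate Ψ t ht).val σ < (Φ.interpolate Ψ t ht).val τ →
      (Φ.interpolate Ψ s hs).val σ ≤ (Φ.interpolate Ψ s hs).val τ :=
    Filter.eventually_all.2 fun σ => Filter.eventually_all.2 fun τ => hev σ τ
  filter_upwards [this] with s hs hs' σ τ
  exact hs σ τ hs'

/-- Stability: the diagrams of two filtrations of a finite set at uniform distance at most `δ`
are matched with cost at most `δ`. -/
theorem Filtration.matched_of_abs_sub_le [Finite X] {Φ Ψ : Filtration X} {δ : ℝ} (hδ₀ : 0 ≤ δ)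
    (hδ : ∀ σ : Finset X, σ.Nonempty → |Φ.val σ - Ψ.val σ| ≤ δ) {k : ℕ} {D₁ D₂ : Multiset Point}
    (hD₁ : IsDiagram (Φ.persistentHomology F k) D₁)
    (hD₂ : IsDiagram (Ψ.persistentHomology F k) D₂) : Matched D₁ D₂ (ENNReal.ofReal δ) := by
  -- The cost is proportional to the length of the parameter interval, so transitivity loses
  -- nothing.
  let r : ℝ → ℝ → Prop := fun s t => ∀ hs ht D D',
    IsDiagram ((Φ.interpolate Ψ s hs).persistentHomology F k) D →
    IsDiagram ((Φ.interpolate Ψ t ht).persistentHomology F k) D' →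
    Matched D D' (ENNReal.ofReal ((t - s) * δ))
  have hcomp : ∀ s t hs ht, s ≤ t →
      (Φ.interpolate Ψ s hs).Comparable (Φ.interpolate Ψ t ht) → r s t := by
    intro s t hs ht hst hc _ _ D D' hD hD'
    obtain ⟨E, E', hE, hE', hEE'⟩ := hc.exists_matched (δ := (t - s) * δ) (fun σ hσ => by
      have : (Φ.interpolate Ψ s hs).val σ - (Φ.interpolate Ψ t ht).val σ =
          (t - s) * (Φ.val σ - Ψ.val σ) := by
        simp only [Filtration.interpolate]
        ring
      rw [this, abs_mul, abs_of_nonneg (sub_nonneg.2 hst)]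
      exact mul_le_mul_of_nonneg_left (hδ σ hσ) (sub_nonneg.2 hst)) F k
    rwa [hD.unique hE, hD'.unique hE']
  have h01 : r 0 1 := by
    refine rel_of_locally zero_le_one (fun s t u hst htu h h' hs hu D D'' hD hD'' => ?_)
      fun t ht => ?_
    · have ht : t ∈ Set.Icc (0 : ℝ) 1 := ⟨hs.1.trans hst, htu.trans hu.2⟩
      obtain ⟨D', hD'⟩ := (Φ.interpolate Ψ t ht).exists_isDiagram F k
      have := (h hs ht D D' hD hD').trans (h' ht hu D' D'' hD' hD'')
      rwa [← ENNReal.ofReal_add (mul_nonneg (sub_nonneg.2 hst) hδ₀)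
        (mul_nonneg (sub_nonneg.2 htu) hδ₀),
        show (t - s) * δ + (u - t) * δ = (u - s) * δ by ring] at this
    · filter_upwards [Φ.eventually_comparable Ψ t ht] with s hc hs
      -- Comparability is symmetric, by contraposition with the two simplices exchanged.
      refine ⟨fun hst => hcomp _ _ hs ht hst fun σ τ h => ?_,
        fun hts => hcomp _ _ ht hs hts (hc hs)⟩
      by_contra hlt
      exact (hc hs τ σ (not_le.1 hlt)).not_gt h
  have h0 : Φ.interpolate Ψ 0 ⟨le_rfl, zero_le_one⟩ = Φ := by simp [Filtration.interpolate]
  have h1 : Φ.interpolate Ψ 1 ⟨zero_le_one, le_rfl⟩ = Ψ := by simp [Filtration.interpolate]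
  have := h01 ⟨le_rfl, zero_le_one⟩ ⟨zero_le_one, le_rfl⟩ D₁ D₂ (by rwa [h0]) (by rwa [h1])
  rwa [sub_zero, one_mul] at this

end Stability

/-! ### Pulling back a filtration along a surjection -/

section Comap

open Classical

variable {X Y : Type*}

/-- The filtration `σ ↦ Φ (π σ)`. -/
def Filtration.comap (Φ : Filtration X) (π : Y → X) : Filtration Y where
  val σ := Φ.val (σ.image π)
  mono := fun _ _ h => Φ.mono (Finset.image_subset_image h)

/-- For a section `s` of `π`, the simplices `σ` and `σ ∪ s (π σ)` have the same image under `π`, so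
they enter together and `s ∘ π` acts trivially on homology (`mapTuples_sub_mem_boundaries`). -/
theorem Filtration.comap_isomorphic (Φ : Filtration X) {π : Y → X} (hπ : Function.Surjective π)
    (F : Type*) [Field F] (k : ℕ) :
    ((Φ.comap π).persistentHomology F k).Isomorphic (Φ.persistentHomology F k) := by
  obtain ⟨s, hs⟩ := hπ.hasRightInverse
  have hπs : π ∘ s = id := funext hs
  have hdown : ∀ ε, ∀ σ ∈ ((Φ.comap π).sublevel ε).faces, σ.image π ∈ (Φ.sublevel ε).faces :=
    fun ε σ hσ => ⟨hσ.1.image π, hσ.2⟩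
  have hup : ∀ ε, ∀ σ ∈ (Φ.sublevel ε).faces, σ.image s ∈ ((Φ.comap π).sublevel ε).faces := by
    refine fun ε σ hσ => ⟨hσ.1.image s, ?_⟩
    change Φ.val ((σ.image s).image π) ≤ ε
    rw [Finset.image_image, hπs, Finset.image_id]
    exact hσ.2
  have hcontig : ∀ ε, ∀ σ ∈ ((Φ.comap π).sublevel ε).faces,
      σ ∪ σ.image (s ∘ π) ∈ ((Φ.comap π).sublevel ε).faces := by
    refine fun ε σ hσ => ⟨hσ.1.mono Finset.subset_union_left, ?_⟩
    change Φ.val ((σ ∪ σ.image (s ∘ π)).image π) ≤ ε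
    rw [Finset.image_union, Finset.image_image, ← Function.comp_assoc, hπs, Function.id_comp,
      Finset.union_self]
    exact hσ.2
  let f : ∀ ε, cycles F ((Φ.comap π).sublevel ε) k →ₗ[F] cycles F (Φ.sublevel ε) k := fun ε =>
    (mapTuples F π k).restrict fun _ hx => mapTuples_mem_cycles (hdown ε) k hx
  let φ : ∀ ε, Homology F ((Φ.comap π).sublevel ε) k →ₗ[F] Homology F (Φ.sublevel ε) k := fun ε =>
    Submodule.mapQ _ _ (f ε) fun x hx => mapTuples_mem_boundaries (hdown ε) k hx
  have hφ : ∀ ε z, φ ε (Submodule.Quotient.mk z) = Submodule.Quotient.mk (f ε z) := fun _ _ => rfl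
  have hinj : ∀ ε, Function.Injective (φ ε) := by
    intro ε
    rw [injective_iff_map_eq_zero]
    intro x hx
    obtain ⟨z, rfl⟩ := Submodule.Quotient.mk_surjective _ x
    rw [hφ, Submodule.Quotient.mk_eq_zero] at hx
    rw [Submodule.Quotient.mk_eq_zero]
    have h1 := mapTuples_mem_boundaries (hup ε) k hx
    have h2 := mapTuples_sub_mem_boundaries (hcontig ε) k z.2
    rw [← mapTuples_mapTuples] at h2
    have h3 := sub_mem h1 h2
    change z.1 ∈ boundaries F ((Φ.comap π).sublevel ε) k
    convert h3 using 1
    exact (sub_sub_cancel _ _).symm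
  have hsurj : ∀ ε, Function.Surjective (φ ε) := by
    intro ε y
    obtain ⟨z, rfl⟩ := Submodule.Quotient.mk_surjective _ y
    refine ⟨Submodule.Quotient.mk ⟨_, mapTuples_mem_cycles (hup ε) k z.2⟩, ?_⟩
    rw [hφ]
    congr 1
    refine Subtype.ext ?_
    change mapTuples F π k (mapTuples F s k z.1) = z.1
    rw [mapTuples_mapTuples, hπs, mapTuples_id]
  refine ⟨fun ε => LinearEquiv.ofBijective (φ ε) ⟨hinj ε, hsurj ε⟩, fun h x => ?_⟩
  obtain ⟨z, rfl⟩ := Submodule.Quotient.mk_surjective _ x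
  rfl

end Comap

/-! ### The Čech filtration -/

section Cech

/-- A centre `ρ q` for the image of `σ` in `Y` yields the centre `π q` in `X`, with radius larger by
at most `δ`. Centres range over all of `Y`, hence the surjectivity of `ρ`. -/
theorem cechFiltration_comap_le {X Y R : Type*} [MetricSpace X] [Finite X] [MetricSpace Y]
    [Finite Y] {π : R → X} {ρ : R → Y} (hρ : Function.Surjective ρ) {δ : ℝ} (hδ₀ : 0 ≤ δ)
    (hδ : ∀ p q, dist (π p) (π q) ≤ dist (ρ p) (ρ q) + δ) {σ : Finset R} (hσ : σ.Nonempty) :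
    ((cechFiltration X).comap π).val σ ≤ ((cechFiltration Y).comap ρ).val σ + δ := by
  classical
  have : Nonempty Y := ⟨ρ hσ.choose⟩
  rw [← sub_le_iff_le_add]
  refine le_ciInf fun y => ?_
  obtain ⟨q, rfl⟩ := hρ y
  rw [sub_le_iff_le_add]
  refine (ciInf_le (Set.finite_range _).bddBelow (π q)).trans (Real.iSup_le ?_ ?_)
  · rintro ⟨x, hx⟩
    obtain ⟨p, hp, rfl⟩ := Finset.mem_image.1 hx
    refine (hδ p q).trans (add_le_add_left ?_ δ)
    exact le_ciSup (f := fun y : (σ.image ρ : Finset Y) => dist (y : Y) (ρ q))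
      (Set.finite_range _).bddAbove ⟨ρ p, Finset.mem_image_of_mem ρ hp⟩
  · exact add_nonneg (Real.iSup_nonneg fun _ => dist_nonneg) hδ₀

theorem bottleneckDist_le_distortion {F : Type*} [Field F] {X Y : Type*} [MetricSpace X] [Finite X]
    [MetricSpace Y] [Finite Y] {k : ℕ} {D₁ D₂ : Multiset Point}
    (hD₁ : IsDiagram ((cechFiltration X).persistentHomology F k) D₁)
    (hD₂ : IsDiagram ((cechFiltration Y).persistentHomology F k) D₂)
    {R : Set (X × Y)} (hR : IsCorrespondence R) : bottleneckDist D₁ D₂ ≤ distortion R := by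
  by_cases htop : distortion R = ⊤
  · rw [htop]
    exact le_top
  let π : R → X := fun p => p.1.1
  let ρ : R → Y := fun p => p.1.2
  have hπ : Function.Surjective π := by
    intro x
    obtain ⟨p, hp, rfl⟩ := hR.1.ge (Set.mem_univ x)
    exact ⟨⟨p, hp⟩, rfl⟩
  have hρ : Function.Surjective ρ := by
    intro y
    obtain ⟨p, hp, rfl⟩ := hR.2.ge (Set.mem_univ y)
    exact ⟨⟨p, hp⟩, rfl⟩
  have hdist : ∀ p q : R, |dist (π p) (π q) - dist (ρ p) (ρ q)| ≤ (distortion R).toReal := by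
    intro p q
    rw [← ENNReal.ofReal_le_iff_le_toReal htop]
    exact le_iSup₂_of_le p.1 p.2 (le_iSup₂_of_le q.1 q.2 le_rfl)
  have h₀ : 0 ≤ (distortion R).toReal := ENNReal.toReal_nonneg
  rw [← ENNReal.ofReal_toReal htop]
  refine (Filtration.matched_of_abs_sub_le h₀ (fun σ hσ => ?_)
    (hD₁.of_isomorphic (Filtration.comap_isomorphic _ hπ F k))
    (hD₂.of_isomorphic (Filtration.comap_isomorphic _ hρ F k))).bottleneckDist_le
  have h1 := cechFiltration_comap_le (π := π) hρ h₀
    (fun p q => by linarith [(abs_le.1 (hdist p q)).2]) hσ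
  have h2 := cechFiltration_comap_le (π := ρ) hπ h₀
    (fun p q => by linarith [(abs_le.1 (hdist p q)).1]) hσ
  exact abs_le.2 ⟨by linarith, by linarith⟩

end Cech

end PersistentHomology

end


theorem theorem5p4 (F : Type*) [Field F]
    (X : Type*) [MetricSpace X] [Finite X] (Y : Type*) [MetricSpace Y] [Finite Y] (k : ℕ) :
    (∃! D : Multiset PersistentHomology.Point, PersistentHomology.IsDiagram
      ((PersistentHomology.cechFiltration X).persistentHomology F k) D) ∧
    (∃! D : Multiset PersistentHomology.Point, PersistentHomology.IsDiagram
      ((PersistentHomology.cechFiltration Y).persistentHomology F k) D) ∧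
    ∀ D₁ D₂ : Multiset PersistentHomology.Point,
      PersistentHomology.IsDiagram
        ((PersistentHomology.cechFiltration X).persistentHomology F k) D₁ →
      PersistentHomology.IsDiagram
        ((PersistentHomology.cechFiltration Y).persistentHomology F k) D₂ →
      PersistentHomology.bottleneckDist D₁ D₂ ≤
        2 * PersistentHomology.gromovHausdorffDist X Y := by
  obtain ⟨D, hD⟩ := (PersistentHomology.cechFiltration X).exists_isDiagram F k
  obtain ⟨D', hD'⟩ := (PersistentHomology.cechFiltration Y).exists_isDiagram F k
  refine ⟨⟨D, hD, fun _ h => h.unique hD⟩, ⟨D', hD', fun _ h => h.unique hD'⟩,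
    fun D₁ D₂ hD₁ hD₂ => ?_⟩
  rw [PersistentHomology.gromovHausdorffDist,
    ENNReal.mul_div_cancel two_ne_zero ENNReal.ofNat_ne_top]
  exact le_iInf₂ fun R hR => PersistentHomology.bottleneckDist_le_distortion hD₁ hD₂ hR
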